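/- Setting. Let $I\subseteq\mathbb R$ be an interval (open, closed, half-open, bounded or unbounded) with nonempty interior, and $n\in\mathbb N$. Let $J\in M_n(\mathbb C)$ with $J\neq 0$ and $J^*=-J$, and let $H,W:I\to M_n(\mathbb C)$ be Lebesgue measurable with $W(t)^*=W(t)\ge 0$ and $\det W(t)\ne 0$ for a.e. $t\in I$. Functions are identified when equal a.e. on $I$. Write $\langle x,y\rangle=x^*y$ on $\mathbb C^n$. Let $L^2(I;W)$ be the Hilbert space of measurable $f:I\to\mathbb C^n$ with $\int_I\langle W f,f\rangle\,dt<\infty$, with inner product $\langle f,g\rangle_W=\int_I\langle W f,g\rangle\,dt$. Put $\mathcal L_H f=W^{-1}\big(\tfrac{d}{dt}(Jf)+Hf\big)$ for measurable $f:I\to\mathbb C^n$ such that $Jf$ is (a.e. equal to) a function that is absolutely continuous on every compact subinterval of $I$; the set of such $f$ is $D(\mathcal L_H)$. Define the maximal operator $L_H$ and the minimal operator $L_{H,0}'$ on $L^2(I;W)$ by $$D(L_H)=\{f\in L^2(I;W): f\in D(\mathcal L_H),\ \mathcal L_Hf\in L^2(I;W)\},\qquad L_Hf=\mathcal L_Hf,$$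 $$D(L_{H,0}')=\{f\in D(L_H): Jf\text{ has compact support contained in the interior of }I\},\qquad L_{H,0}'f=\mathcal L_Hf,$$ and write $L=L_H$, $L_0'=L_{H,0}'$. The operators $L_{H^*}$ and $L_{H^*,0}'$ are defined in the same way with $H^*$ (pointwise conjugate transpose) in place of $H$. Local index-1 hypotheses. If $\det J\neq0$: all entries of $H$ and $W$ are in $L^1_{loc}(I)$. If $\det J=0$: let $n_1=\operatorname{rank}J$, $n_2=n-n_1$, let $V$ be a unitary matrix such that $V^{-1}JV=\begin{bmatrix}J_{11}&0\\0&0\end{bmatrix}$ with $J_{11}\in M_{n_1}(\mathbb C)$ invertible, and let $H_{ij},W_{ij}$ ($i,j=1,2$) be the blocks of $V^{-1}HV$ and $V^{-1}WV$ in the conformal partition (the choice of $V$ is immaterial). Then $H_{22}(t)$ is invertible for a.e. $t\in I$, and, entrywise, $$H_{12}H_{22}^{-1}W_{22}^{1/2}\in L^2_{loc}(I),\quad H_{11}-H_{12}H_{22}^{-1}H_{21}\in L^1_{loc}(I),\quad W_{11}\in L^1_{loc}(I),\quad W_{22}^{1/2}H_{22}^{-1}W_{22}^{1/2}\in L^\infty_{loc}(I),$$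 $$W_{22}^{1/2}\big(W_{22}^{-1}W_{21}-H_{22}^{-1}H_{21}\big)\in L^2_{loc}(I),\quad W_{11}-W_{12}W_{22}^{-1}W_{21}\in L^1_{loc}(I).$$ Here $L^p_{loc}(I)$ is the space of measurable functions on $I$ that are in $L^p([a,b])$ for every compact interval $[a,b]\subseteq I$. Theorem. Under the local index-1 hypotheses, the following hold. (i) $D(L_0')$, $D(L_{H^*,0}')$, $D(L)$ and $D(L_{H^*})$ are dense in $L^2(I;W)$. (ii) $L_{H^*}$ is closed, $L_0'$ is closable with closure $\overline{L_0'}=(L_0')^{**}$, and $$(L_0')^*=(\overline{L_0'})^*=L_{H^*}=\overline{L_{H^*}}=(L_{H^*})^{**},\qquad (L_{H^*})^*=\overline{L_0'}.$$ (iii) $L$ is closed, $L_{H^*,0}'$ is closable with closure $\overline{L_{H^*,0}'}=(L_{H^*,0}')^{**}$, and $$(L_{H^*,0}')^*=(\overline{L_{H^*,0}'})^*=L=\overline{L}=L^{**},\qquad L^*=\overline{L_{H^*,0}'}.$$ -/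

import Mathlib

open MeasureTheory Matrix
open scoped ComplexOrder

section SquareRoot

open scoped MatrixOrder

/-- The positive semidefinite square root `A ^ (1/2)` of a positive semidefinite matrix `A`
(the value at other matrices is never used). -/
noncomputable def psdSqrt {m : ℕ} (A : Matrix (Fin m) (Fin m) ℂ) : Matrix (Fin m) (Fin m) ℂ :=
  CFC.sqrt A

theorem psdSqrt_isHermitian {m : ℕ} {A : Matrix (Fin m) (Fin m) ℂ} :
    (psdSqrt A)ᴴ = psdSqrt A :=
  (Matrix.nonneg_iff_posSemidef.mp (CFC.sqrt_nonneg A)).isHermitian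

theorem psdSqrt_mul_self {m : ℕ} {A : Matrix (Fin m) (Fin m) ℂ} (hA : A.PosSemidef) :
    psdSqrt A * psdSqrt A = A :=
  CFC.sqrt_mul_sqrt_self A hA.nonneg

section

open scoped Matrix.Norms.L2Operator

theorem continuous_psdSqrt_abs {m : ℕ} :
    Continuous fun A : Matrix (Fin m) (Fin m) ℂ => psdSqrt (CFC.abs A) :=
  CFC.continuousOn_sqrt.comp_continuous CFC.continuous_abs (fun A => CFC.abs_nonneg A)

end

theorem psdSqrt_abs {m : ℕ} {A : Matrix (Fin m) (Fin m) ℂ} (hA : A.PosSemidef) :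
    psdSqrt (CFC.abs A) = psdSqrt A := by
  rw [CFC.abs_of_nonneg A hA.nonneg]

theorem aestronglyMeasurable_psdSqrt {m : ℕ} {μ : Measure ℝ} {A : ℝ → Matrix (Fin m) (Fin m) ℂ}
    (hA : ∀ i j, AEStronglyMeasurable (fun t => A t i j) μ)
    (hpos : ∀ᵐ t ∂μ, (A t).PosSemidef) (i j : Fin m) :
    AEStronglyMeasurable (fun t => psdSqrt (A t) i j) μ := by
  have h1 : AEMeasurable (fun t => fun i j => A t i j) μ :=
    aemeasurable_pi_lambda _ fun i => aemeasurable_pi_lambda _ fun j => (hA i j).aemeasurable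
  have h2 : AEStronglyMeasurable (fun t => A t) μ := h1.aestronglyMeasurable
  have h3 := continuous_psdSqrt_abs.comp_aestronglyMeasurable h2
  have h4 : Continuous fun B : Matrix (Fin m) (Fin m) ℂ => B i j := by fun_prop
  refine (h4.comp_aestronglyMeasurable h3).congr ?_
  filter_upwards [hpos] with t ht
  simp [psdSqrt_abs ht]

end SquareRoot

/-- A weight on `I`: a measurable matrix-valued function which is positive semidefinite and
invertible at almost every point of `I`. -/
structure Weight (n : ℕ) (I : Set ℝ) where
  toFun : ℝ → Matrix (Fin n) (Fin n) ℂ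
  measurable : ∀ i j, AEStronglyMeasurable (fun t => toFun t i j) (volume.restrict I)
  posSemidef : ∀ᵐ t ∂volume.restrict I, (toFun t).PosSemidef
  det_ne_zero : ∀ᵐ t ∂volume.restrict I, (toFun t).det ≠ 0

namespace Weight

variable {n : ℕ} {I : Set ℝ}

/-- The pointwise weighted inner product `⟨W(t) x, y⟩ = (W(t) x)^* y`. -/
noncomputable def innerAt (W : Weight n I) (t : ℝ) (x y : Fin n → ℂ) : ℂ :=
  star (W.toFun t *ᵥ x) ⬝ᵥ y

/-- The vector `W(t)^(1/2) x`, with its Euclidean norm. -/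
noncomputable def sqrtMul (W : Weight n I) (t : ℝ) (x : Fin n → ℂ) : EuclideanSpace ℂ (Fin n) :=
  WithLp.toLp 2 (psdSqrt (W.toFun t) *ᵥ x)

theorem innerAt_eq (W : Weight n I) {t : ℝ} (ht : (W.toFun t).PosSemidef) (x y : Fin n → ℂ) :
    W.innerAt t x y = inner ℂ (W.sqrtMul t x) (W.sqrtMul t y) := by
  rw [innerAt, sqrtMul, sqrtMul, EuclideanSpace.inner_toLp_toLp, dotProduct_comm _ (star _)]
  conv_lhs => rw [← psdSqrt_mul_self ht]
  rw [← mulVec_mulVec, star_mulVec, psdSqrt_isHermitian, dotProduct_mulVec]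

theorem isUnit_psdSqrt (W : Weight n I) {t : ℝ} (ht : (W.toFun t).PosSemidef)
    (hd : (W.toFun t).det ≠ 0) : IsUnit (psdSqrt (W.toFun t)).det := by
  rw [← psdSqrt_mul_self ht, det_mul] at hd
  exact (left_ne_zero_of_mul hd).isUnit

theorem aestronglyMeasurable_mulVec {μ : Measure ℝ} {A : ℝ → Matrix (Fin n) (Fin n) ℂ}
    (hA : ∀ i j, AEStronglyMeasurable (fun t => A t i j) μ) {f : ℝ → Fin n → ℂ}
    (hf : AEStronglyMeasurable f μ) : AEStronglyMeasurable (fun t => A t *ᵥ f t) μ := by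
  refine (aemeasurable_pi_lambda _ fun i => ?_).aestronglyMeasurable
  refine AEStronglyMeasurable.aemeasurable (f := fun t => ∑ j, A t i j * f t j) ?_
  refine Finset.aestronglyMeasurable_fun_sum _ fun j _ => (hA i j).mul ?_
  exact (continuous_apply j).comp_aestronglyMeasurable hf

theorem aestronglyMeasurable_sqrtMul (W : Weight n I) {f : ℝ → Fin n → ℂ}
    (hf : AEStronglyMeasurable f (volume.restrict I)) :
    AEStronglyMeasurable (fun t => W.sqrtMul t (f t)) (volume.restrict I) :=
  (PiLp.continuous_toLp 2 _).comp_aestronglyMeasurable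
    (aestronglyMeasurable_mulVec (aestronglyMeasurable_psdSqrt W.measurable W.posSemidef) hf)

theorem integrable_innerAt_self_iff (W : Weight n I) {f : ℝ → Fin n → ℂ}
    (hf : AEStronglyMeasurable f (volume.restrict I)) :
    Integrable (fun t => W.innerAt t (f t) (f t)) (volume.restrict I) ↔
      MemLp (fun t => W.sqrtMul t (f t)) 2 (volume.restrict I) := by
  rw [memLp_two_iff_integrable_sq_norm (W.aestronglyMeasurable_sqrtMul hf)]
  have h : (fun t => W.innerAt t (f t) (f t)) =ᵐ[volume.restrict I]
      fun t => ((‖W.sqrtMul t (f t)‖ ^ 2 : ℝ) : ℂ) := by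
    filter_upwards [W.posSemidef] with t ht
    rw [W.innerAt_eq ht, inner_self_eq_norm_sq_to_K]
    simp
  rw [integrable_congr h]
  exact ⟨fun h => by simpa only [RCLike.re_to_complex, Complex.ofReal_re] using h.re, fun h => h.ofReal⟩

theorem sqrtMul_add (W : Weight n I) (t : ℝ) (x y : Fin n → ℂ) :
    W.sqrtMul t (x + y) = W.sqrtMul t x + W.sqrtMul t y := by
  simp [sqrtMul, mulVec_add]

theorem sqrtMul_smul (W : Weight n I) (t : ℝ) (c : ℂ) (x : Fin n → ℂ) :
    W.sqrtMul t (c • x) = c • W.sqrtMul t x := by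
  simp [sqrtMul, mulVec_smul]

/-- The subspace of those measurable `f : I → ℂⁿ` (up to equality a.e. on `I`) for which the
nonnegative function `⟨W f, f⟩` has finite integral over `I`. -/
noncomputable def l2Submodule (W : Weight n I) :
    Submodule ℂ (ℝ →ₘ[volume.restrict I] (Fin n → ℂ)) where
  carrier := {f | Integrable (fun t => W.innerAt t (f t) (f t)) (volume.restrict I)}
  zero_mem' := by
    refine (integrable_zero ℝ ℂ _).congr ?_
    filter_upwards [AEEqFun.coeFn_zero (μ := volume.restrict I) (α := ℝ) (β := Fin n → ℂ)] with t ht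
    simp [ht, innerAt]
  add_mem' {f g} hf hg := by
    rw [Set.mem_ofPred_eq, integrable_innerAt_self_iff _ (AEEqFun.aestronglyMeasurable _)] at *
    refine (hf.add hg).ae_eq ?_
    filter_upwards [AEEqFun.coeFn_add f g] with t ht
    simp [ht, sqrtMul_add]
  smul_mem' c f hf := by
    rw [Set.mem_ofPred_eq, integrable_innerAt_self_iff _ (AEEqFun.aestronglyMeasurable _)] at *
    refine (hf.const_smul c).ae_eq ?_
    filter_upwards [AEEqFun.coeFn_smul c f] with t ht
    simp [ht, sqrtMul_smul]

/-- The weighted space `L²(I; W)`. -/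
def L2 (W : Weight n I) : Type := W.l2Submodule

namespace L2

variable {W : Weight n I}

noncomputable instance : AddCommGroup (L2 W) := inferInstanceAs (AddCommGroup W.l2Submodule)

noncomputable instance : Module ℂ (L2 W) := inferInstanceAs (Module ℂ W.l2Submodule)

/-- A representative `ℝ → ℂⁿ` of an element of `L²(I; W)`; only its values a.e. on `I` matter. -/
noncomputable instance : CoeFun (L2 W) fun _ => ℝ → Fin n → ℂ := ⟨fun f => f.1⟩

theorem coeFn_add (f g : L2 W) : ⇑(f + g) =ᵐ[volume.restrict I] fun t => f t + g t :=
  AEEqFun.coeFn_add f.1 g.1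

theorem coeFn_smul (c : ℂ) (f : L2 W) : ⇑(c • f) =ᵐ[volume.restrict I] fun t => c • f t :=
  AEEqFun.coeFn_smul c f.1

theorem coeFn_zero : ⇑(0 : L2 W) =ᵐ[volume.restrict I] fun _ => 0 :=
  AEEqFun.coeFn_zero

theorem ext {f g : L2 W} (h : ∀ᵐ t ∂volume.restrict I, f t = g t) : f = g :=
  Subtype.ext (AEEqFun.ext h)

theorem aestronglyMeasurable (f : L2 W) : AEStronglyMeasurable f (volume.restrict I) :=
  AEEqFun.aestronglyMeasurable f.1

theorem memLp (f : L2 W) : MemLp (fun t => W.sqrtMul t (f t)) 2 (volume.restrict I) :=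
  (W.integrable_innerAt_self_iff f.aestronglyMeasurable).mp f.2

/-- Left multiplication by `W^(1/2)`, a linear bijection of `L²(I; W)` onto `[L²(I)]ⁿ`. -/
noncomputable def toLp (W : Weight n I) :
    L2 W →ₗ[ℂ] Lp (EuclideanSpace ℂ (Fin n)) 2 (volume.restrict I) where
  toFun f := f.memLp.toLp
  map_add' f g := by
    rw [← MemLp.toLp_add]
    refine MemLp.toLp_congr _ _ ?_
    filter_upwards [coeFn_add f g] with t ht
    simp [ht, sqrtMul_add]
  map_smul' c f := by
    rw [RingHom.id_apply, ← MemLp.toLp_const_smul]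
    refine MemLp.toLp_congr _ _ ?_
    filter_upwards [coeFn_smul c f] with t ht
    simp [ht, sqrtMul_smul]

theorem toLp_injective : Function.Injective (toLp W) := by
  intro f g h
  have h1 : (fun t => W.sqrtMul t (f t)) =ᵐ[volume.restrict I] fun t => W.sqrtMul t (g t) :=
    (MemLp.toLp_eq_toLp_iff f.memLp g.memLp).mp h
  refine ext ?_
  filter_upwards [h1, W.posSemidef, W.det_ne_zero] with t h2 h3 h4
  have h5 : psdSqrt (W.toFun t) *ᵥ f t = psdSqrt (W.toFun t) *ᵥ g t :=
    (WithLp.toLp_injective 2) h2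
  exact Matrix.mulVec_injective_of_isUnit
    ((Matrix.isUnit_iff_isUnit_det _).mpr (W.isUnit_psdSqrt h3 h4)) h5

theorem toLp_surjective : Function.Surjective (toLp W) := by
  intro g
  have hS := aestronglyMeasurable_psdSqrt W.measurable W.posSemidef
  have hinv : ∀ i j, AEStronglyMeasurable (fun t => (psdSqrt (W.toFun t))⁻¹ i j)
      (volume.restrict I) := by
    intro i j
    have h1 : AEMeasurable (fun t => fun i j => psdSqrt (W.toFun t) i j) (volume.restrict I) :=
      aemeasurable_pi_lambda _ fun i => aemeasurable_pi_lambda _ fun j => (hS i j).aemeasurable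
    have h2 : AEStronglyMeasurable (fun t => psdSqrt (W.toFun t)) (volume.restrict I) :=
      h1.aestronglyMeasurable
    have h3 : Continuous fun B : Matrix (Fin n) (Fin n) ℂ => B.det := by fun_prop
    have h4 : Continuous fun B : Matrix (Fin n) (Fin n) ℂ => B.adjugate i j := by fun_prop
    have h5 := ((h3.comp_aestronglyMeasurable h2).aemeasurable.inv).aestronglyMeasurable.mul
      (h4.comp_aestronglyMeasurable h2)
    refine h5.congr (Filter.Eventually.of_forall fun t => ?_)
    simp [Matrix.inv_def]
  have hm : AEStronglyMeasurable (fun t => (psdSqrt (W.toFun t))⁻¹ *ᵥ WithLp.ofLp (g t))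
      (volume.restrict I) :=
    aestronglyMeasurable_mulVec hinv
      ((PiLp.continuous_ofLp 2 _).comp_aestronglyMeasurable (Lp.aestronglyMeasurable g))
  have hae : (fun t => W.sqrtMul t (AEEqFun.mk _ hm t)) =ᵐ[volume.restrict I] g := by
    filter_upwards [AEEqFun.coeFn_mk _ hm, W.posSemidef, W.det_ne_zero] with t h1 h2 h3
    rw [h1, sqrtMul, mulVec_mulVec, Matrix.mul_nonsing_inv _ (W.isUnit_psdSqrt h2 h3), one_mulVec]
  let f : L2 W := ⟨AEEqFun.mk _ hm, (W.integrable_innerAt_self_iff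
    (AEEqFun.aestronglyMeasurable _)).mpr ((Lp.memLp g).ae_eq hae.symm)⟩
  exact ⟨f, Lp.ext (f.memLp.coeFn_toLp.trans hae)⟩

/-- The inner product `⟨f, g⟩_W = ∫_I ⟨W f, g⟩ dt`, conjugate-linear in `f`. -/
noncomputable instance : Inner ℂ (L2 W) := ⟨fun f g => ∫ t in I, W.innerAt t (f t) (g t)⟩

theorem inner_def (f g : L2 W) : inner ℂ f g = ∫ t in I, W.innerAt t (f t) (g t) := rfl

theorem inner_toLp (f g : L2 W) : inner ℂ (toLp W f) (toLp W g) = inner ℂ f g := by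
  rw [inner_def, MeasureTheory.L2.inner_def]
  refine integral_congr_ae ?_
  filter_upwards [W.posSemidef, f.memLp.coeFn_toLp, g.memLp.coeFn_toLp] with t h1 h2 h3
  rw [W.innerAt_eq h1, ← h2, ← h3]
  rfl

noncomputable abbrev core : InnerProductSpace.Core ℂ (L2 W) where
  inner f g := inner ℂ f g
  conj_inner_symm f g := by rw [← inner_toLp, ← inner_toLp, inner_conj_symm]
  re_inner_nonneg f := by rw [← inner_toLp]; exact inner_self_nonneg
  add_left f g h := by simp only [← inner_toLp, map_add, inner_add_left]
  smul_left f g c := by simp only [← inner_toLp, map_smul, inner_smul_left]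
  definite f h := by
    rw [← inner_toLp, inner_self_eq_zero] at h
    exact toLp_injective (h.trans (map_zero _).symm)

noncomputable instance : NormedAddCommGroup (L2 W) := core.toNormedAddCommGroup

noncomputable instance : InnerProductSpace ℂ (L2 W) := InnerProductSpace.ofCore core.toCore

/-- `toLp` as an isometric isomorphism. -/
noncomputable def toLpEquiv (W : Weight n I) :
    L2 W ≃ₗᵢ[ℂ] Lp (EuclideanSpace ℂ (Fin n)) 2 (volume.restrict I) where
  toLinearEquiv := LinearEquiv.ofBijective (toLp W) ⟨toLp_injective, toLp_surjective⟩
  norm_map' f := by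
    change ‖toLp W f‖ = ‖f‖
    rw [norm_eq_sqrt_re_inner (𝕜 := ℂ) f, norm_eq_sqrt_re_inner (𝕜 := ℂ), inner_toLp]

instance : CompleteSpace (L2 W) :=
  (completeSpace_congr (e := (toLpEquiv W).toEquiv)
    (toLpEquiv W).isometry.isUniformInducing.isUniformEmbedding).mpr inferInstance

end L2

end Weight

/-- `φ ∈ L^p_loc(I)`: measurable on `I` and `p`-integrable on every compact subinterval of `I`. -/
def MemLpLoc (p : ENNReal) (I : Set ℝ) (φ : ℝ → ℂ) : Prop :=
  AEStronglyMeasurable φ (volume.restrict I) ∧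
    ∀ a b : ℝ, Set.Icc a b ⊆ I → MemLp φ p (volume.restrict (Set.Icc a b))

/-- A matrix-valued function all of whose entries lie in `L^p_loc(I)`. -/
def MatMemLpLoc {m n : Type*} (p : ENNReal) (I : Set ℝ) (A : ℝ → Matrix m n ℂ) : Prop :=
  ∀ i j, MemLpLoc p I fun t => A t i j

/-- `u ∈ [AC_loc(I)]ⁿ`: every component is absolutely continuous on every compact subinterval
of `I`. -/
def IsACLoc {n : ℕ} (I : Set ℝ) (u : ℝ → Fin n → ℂ) : Prop :=
  ∀ i, ∀ a b : ℝ, a ≤ b → Set.Icc a b ⊆ I → AbsolutelyContinuousOnInterval (fun t => u t i) a b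

section Operators

variable {n : ℕ} {I : Set ℝ}

/-- `f ∈ D(𝓛)` and `𝓛 f = g` a.e. on `I`, where `𝓛 f = W⁻¹ ((J f)' + H f)` is the
differential-algebraic operator: `J f` agrees a.e. on `I` with some `u ∈ [AC_loc(I)]ⁿ`, `u` has
derivative `v` a.e. on `I`, and `g = W⁻¹ (v + H f)` a.e. on `I`. -/
def IsDAImage (I : Set ℝ) (J : Matrix (Fin n) (Fin n) ℂ) (H W : ℝ → Matrix (Fin n) (Fin n) ℂ)
    (f g : ℝ → Fin n → ℂ) : Prop :=
  ∃ u v : ℝ → Fin n → ℂ, IsACLoc I u ∧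
    (∀ᵐ t ∂volume.restrict I, J *ᵥ f t = u t) ∧
    (∀ᵐ t ∂volume.restrict I, HasDerivAt u (v t) t) ∧
    ∀ᵐ t ∂volume.restrict I, g t = (W t)⁻¹ *ᵥ (v t + H t *ᵥ f t)

theorem IsDAImage.congr {J : Matrix (Fin n) (Fin n) ℂ} {H W : ℝ → Matrix (Fin n) (Fin n) ℂ}
    {f g f' g' : ℝ → Fin n → ℂ} (h : IsDAImage I J H W f g)
    (hf : f =ᵐ[volume.restrict I] f') (hg : g =ᵐ[volume.restrict I] g') :
    IsDAImage I J H W f' g' := by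
  obtain ⟨u, v, h1, h2, h3, h4⟩ := h
  refine ⟨u, v, h1, ?_, h3, ?_⟩
  · filter_upwards [h2, hf] with t h5 h6
    rw [← h6, h5]
  · filter_upwards [h4, hf, hg] with t h5 h6 h7
    rw [← h6, ← h7, h5]

theorem IsACLoc.add {u v : ℝ → Fin n → ℂ} (hu : IsACLoc I u) (hv : IsACLoc I v) :
    IsACLoc I fun t => u t + v t :=
  fun i a b hab h => (hu i a b hab h).add (hv i a b hab h)

theorem IsACLoc.const_smul {u : ℝ → Fin n → ℂ} (c : ℂ) (hu : IsACLoc I u) :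
    IsACLoc I fun t => c • u t :=
  fun i a b hab h => (hu i a b hab h).const_smul c

theorem IsACLoc.zero : IsACLoc I (0 : ℝ → Fin n → ℂ) := fun i a b _ _ =>
  (LipschitzOnWith.of_dist_le_mul (K := 0) (by simp)).absolutelyContinuousOnInterval

theorem IsACLoc.continuousAt {u : ℝ → Fin n → ℂ} (hu : IsACLoc I u) {t : ℝ}
    (ht : t ∈ interior I) : ContinuousAt u t := by
  rw [mem_interior_iff_mem_nhds] at ht
  obtain ⟨ε, hε, h⟩ := Metric.nhds_basis_closedBall.mem_iff.mp ht
  rw [Real.closedBall_eq_Icc] at h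
  refine continuousAt_pi.mpr fun i => ?_
  have h1 := (hu i (t - ε) (t + ε) (by linarith) h).continuousOn
  rw [Set.uIcc_of_le (by linarith)] at h1
  exact h1.continuousAt (Icc_mem_nhds (by linarith) (by linarith))

/-- The graph `{(f, g) : f, g ∈ L²(I; W), f ∈ D(𝓛), 𝓛 f = g}` of the maximal operator. -/
noncomputable def maxGraph (W : Weight n I) (J : Matrix (Fin n) (Fin n) ℂ)
    (H : ℝ → Matrix (Fin n) (Fin n) ℂ) : Submodule ℂ (W.L2 × W.L2) where
  carrier := {p | IsDAImage I J H W.toFun p.1 p.2}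
  zero_mem' := by
    refine ⟨0, 0, IsACLoc.zero, ?_, ?_, ?_⟩
    · filter_upwards [Weight.L2.coeFn_zero (W := W)] with t ht
      simp [ht]
    · exact Filter.Eventually.of_forall fun t => hasDerivAt_const t 0
    · filter_upwards [Weight.L2.coeFn_zero (W := W)] with t ht
      simp [ht]
  add_mem' {p q} := by
    rintro ⟨u, v, h1, h2, h3, h4⟩ ⟨u', v', h1', h2', h3', h4'⟩
    refine ⟨_, fun t => v t + v' t, h1.add h1', ?_, ?_, ?_⟩
    · filter_upwards [h2, h2', Weight.L2.coeFn_add p.1 q.1] with t a b c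
      rw [Prod.fst_add, c, mulVec_add, a, b]
    · filter_upwards [h3, h3'] with t a b
      exact a.add b
    · filter_upwards [h4, h4', Weight.L2.coeFn_add p.1 q.1, Weight.L2.coeFn_add p.2 q.2]
        with t a b c d
      rw [Prod.snd_add, Prod.fst_add, c, d, a, b, ← mulVec_add, mulVec_add (H t)]
      congr 1
      abel
  smul_mem' k p := by
    rintro ⟨u, v, h1, h2, h3, h4⟩
    refine ⟨_, fun t => k • v t, h1.const_smul k, ?_, ?_, ?_⟩
    · filter_upwards [h2, Weight.L2.coeFn_smul k p.1] with t a c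
      rw [Prod.smul_fst, c, mulVec_smul, a]
    · filter_upwards [h3] with t a
      exact a.const_smul k
    · filter_upwards [h4, Weight.L2.coeFn_smul k p.1, Weight.L2.coeFn_smul k p.2] with t a c d
      rw [Prod.smul_snd, Prod.smul_fst, c, d, a, mulVec_smul, ← smul_add, mulVec_smul]

/-- The maximal operator `L : D(L) → L²(I; W)`:
`D(L) = {f ∈ L²(I; W) : f ∈ D(𝓛), 𝓛 f ∈ L²(I; W)}` and `L f = 𝓛 f`. -/
noncomputable def maxOp (W : Weight n I) (J : Matrix (Fin n) (Fin n) ℂ)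
    (H : ℝ → Matrix (Fin n) (Fin n) ℂ) : W.L2 →ₗ.[ℂ] W.L2 :=
  (maxGraph W J H).toLinearPMap

/-- `J f` vanishes off a compact subset of the interior of `I`. -/
def HasCompactSupportIn (I : Set ℝ) (J : Matrix (Fin n) (Fin n) ℂ) (f : ℝ → Fin n → ℂ) : Prop :=
  ∃ K : Set ℝ, IsCompact K ∧ K ⊆ interior I ∧
    ∀ᵐ t ∂volume.restrict I, t ∉ K → J *ᵥ f t = 0

/-- The elements of `D(L)` for which `J f` has compact support contained in the interior
of `I`. (The continuous representative of `J f` vanishes on `I \ K` as soon as it does so a.e.) -/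
noncomputable def minDomain (W : Weight n I) (J : Matrix (Fin n) (Fin n) ℂ)
    (H : ℝ → Matrix (Fin n) (Fin n) ℂ) : Submodule ℂ W.L2 where
  carrier := {f | f ∈ (maxOp W J H).domain ∧ HasCompactSupportIn I J f}
  zero_mem' := by
    refine ⟨Submodule.zero_mem _, ∅, isCompact_empty, Set.empty_subset _, ?_⟩
    filter_upwards [Weight.L2.coeFn_zero (W := W)] with t ht _
    simp [ht]
  add_mem' {f g} := by
    rintro ⟨hf, K, h1, h2, h3⟩ ⟨hg, K', h1', h2', h3'⟩
    refine ⟨Submodule.add_mem _ hf hg, K ∪ K', h1.union h1', Set.union_subset h2 h2', ?_⟩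
    filter_upwards [h3, h3', Weight.L2.coeFn_add f g] with t a b c d
    rw [c, mulVec_add, a fun h => d (Or.inl h), b fun h => d (Or.inr h), add_zero]
  smul_mem' k f := by
    rintro ⟨hf, K, h1, h2, h3⟩
    refine ⟨Submodule.smul_mem _ k hf, K, h1, h2, ?_⟩
    filter_upwards [h3, Weight.L2.coeFn_smul k f] with t a c d
    rw [c, mulVec_smul, a d, smul_zero]

/-- The minimal operator `L₀' : D(L₀') → L²(I; W)`, the restriction of `L` to `D(L₀')`. -/
noncomputable def minOp (W : Weight n I) (J : Matrix (Fin n) (Fin n) ℂ)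
    (H : ℝ → Matrix (Fin n) (Fin n) ℂ) : W.L2 →ₗ.[ℂ] W.L2 :=
  (maxOp W J H).domRestrict (minDomain W J H)

/-- On an interval `𝓛` is single-valued, so `maxOp` has the intended graph. -/
theorem maxGraph_functional (hI : I.OrdConnected) (W : Weight n I)
    (J : Matrix (Fin n) (Fin n) ℂ) (H : ℝ → Matrix (Fin n) (Fin n) ℂ) :
    ∀ p ∈ maxGraph W J H, p.1 = 0 → p.2 = 0 := by
  rintro ⟨f, g⟩ ⟨u, v, h1, h2, h3, h4⟩ (rfl : f = 0)
  have h5 : ∀ᵐ t ∂volume.restrict I, u t = 0 := by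
    filter_upwards [h2, Weight.L2.coeFn_zero (W := W)] with t a b
    rw [← a, b, mulVec_zero]
  have h6 : ∀ t ∈ interior I, u t = 0 := by
    have h7 : u =ᵐ[volume.restrict (interior I)] 0 := ae_restrict_of_ae_restrict_of_subset
      interior_subset h5
    have := Measure.eqOn_open_of_ae_eq h7 isOpen_interior
      (fun t ht => (h1.continuousAt ht).continuousWithinAt) continuousOn_const
    exact fun t ht => this ht
  have h8 : ∀ᵐ t ∂volume.restrict I, t ∈ interior I := by
    rw [ae_restrict_iff' hI.measurableSet]
    have h9 : volume (frontier I) = 0 := hI.convex.addHaar_frontier volume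
    filter_upwards [measure_eq_zero_iff_ae_notMem.mp h9] with t a b
    by_contra hc
    exact a ⟨subset_closure b, hc⟩
  refine Weight.L2.ext ?_
  filter_upwards [h3, h4, h8, Weight.L2.coeFn_zero (W := W)] with t a b c d
  have h10 : u =ᶠ[nhds t] fun _ => 0 := by
    filter_upwards [isOpen_interior.mem_nhds c] with s hs using h6 s hs
  have h11 : v t = 0 := a.unique ((hasDerivAt_const t 0).congr_of_eventuallyEq h10)
  change g t = (0 : W.L2) t
  rw [b, h11, d]
  simp

theorem maxOp_graph (hI : I.OrdConnected) (W : Weight n I) (J : Matrix (Fin n) (Fin n) ℂ)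
    (H : ℝ → Matrix (Fin n) (Fin n) ℂ) : (maxOp W J H).graph = maxGraph W J H :=
  Submodule.toLinearPMap_graph_eq _ (maxGraph_functional hI W J H)

theorem minOp_domain (W : Weight n I) (J : Matrix (Fin n) (Fin n) ℂ)
    (H : ℝ → Matrix (Fin n) (Fin n) ℂ) : (minOp W J H).domain = minDomain W J H :=
  inf_eq_left.mpr fun _ h => h.1

/-- `V` is a unitary matrix (with its columns split into two groups of `n₁` and `n₂` columns)
such that `V⁻¹ J V = Vᴴ J V` is block diagonal with invertible upper left block and other
blocks zero. -/
def IsBlockBasis {n₁ n₂ : ℕ} (J : Matrix (Fin n) (Fin n) ℂ)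
    (V : Matrix (Fin n) (Fin n₁ ⊕ Fin n₂) ℂ) : Prop :=
  Vᴴ * V = 1 ∧ V * Vᴴ = 1 ∧
    ∃ J₁₁ : Matrix (Fin n₁) (Fin n₁) ℂ, J₁₁.det ≠ 0 ∧ Vᴴ * J * V = fromBlocks J₁₁ 0 0 0

/-- The conditions of the local index-1 hypotheses for singular `J`, in terms of the blocks
`H_ij`, `W_ij` of `V⁻¹ H V` and `V⁻¹ W V`. -/
structure BlockIndexOne {n₁ n₂ : ℕ} (I : Set ℝ) (H W : ℝ → Matrix (Fin n) (Fin n) ℂ)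
    (V : Matrix (Fin n) (Fin n₁ ⊕ Fin n₂) ℂ) : Prop where
  det_H₂₂ : ∀ᵐ t ∂volume.restrict I, (Vᴴ * H t * V).toBlocks₂₂.det ≠ 0
  cond_H₁₂ : MatMemLpLoc 2 I fun t =>
    (Vᴴ * H t * V).toBlocks₁₂ * (Vᴴ * H t * V).toBlocks₂₂⁻¹ * psdSqrt (Vᴴ * W t * V).toBlocks₂₂
  schur_H : MatMemLpLoc 1 I fun t => (Vᴴ * H t * V).toBlocks₁₁ -
    (Vᴴ * H t * V).toBlocks₁₂ * (Vᴴ * H t * V).toBlocks₂₂⁻¹ * (Vᴴ * H t * V).toBlocks₂₁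
  cond_W₁₁ : MatMemLpLoc 1 I fun t => (Vᴴ * W t * V).toBlocks₁₁
  cond_H₂₂ : MatMemLpLoc ⊤ I fun t => psdSqrt (Vᴴ * W t * V).toBlocks₂₂ *
    (Vᴴ * H t * V).toBlocks₂₂⁻¹ * psdSqrt (Vᴴ * W t * V).toBlocks₂₂
  cond_H₂₁ : MatMemLpLoc 2 I fun t => psdSqrt (Vᴴ * W t * V).toBlocks₂₂ *
    ((Vᴴ * W t * V).toBlocks₂₂⁻¹ * (Vᴴ * W t * V).toBlocks₂₁ -
      (Vᴴ * H t * V).toBlocks₂₂⁻¹ * (Vᴴ * H t * V).toBlocks₂₁)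
  schur_W : MatMemLpLoc 1 I fun t => (Vᴴ * W t * V).toBlocks₁₁ -
    (Vᴴ * W t * V).toBlocks₁₂ * (Vᴴ * W t * V).toBlocks₂₂⁻¹ * (Vᴴ * W t * V).toBlocks₂₁

/-- The local index-1 hypotheses for `H, W` with respect to `J` on `I`. In the singular case they
are required for one block basis `V`; another choice of `V` changes the blocks only by constant
unitary factors, so the choice does not matter. -/
def LocalIndexOne (I : Set ℝ) (J : Matrix (Fin n) (Fin n) ℂ)
    (H W : ℝ → Matrix (Fin n) (Fin n) ℂ) : Prop :=
  (J.det ≠ 0 → MatMemLpLoc 1 I H ∧ MatMemLpLoc 1 I W) ∧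
    (J.det = 0 → ∃ (n₁ n₂ : ℕ) (V : Matrix (Fin n) (Fin n₁ ⊕ Fin n₂) ℂ),
      IsBlockBasis J V ∧ BlockIndexOne I H W V)

end Operators

/-!
Write `T₀` for the minimal operator of `H` and `T` for the maximal operator of the conjugate
transpose of `H`. Everything follows from one identity: the adjoint relation of the graph of `T₀`
is the graph of `T` (`Reduction.graph_adjoint_minOp`). As this relation is single valued, `T₀` is
densely defined (`LinearPMap.dense_domain_of_graph_adjoint`), and the maximal operator of `H`
extends `T₀`. Exchanging the two coefficients gives the same for the conjugate transpose, and the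
statements on closures and second adjoints are then formal (`LinearPMap.adjoint_pair`).

*Reduction.* In coordinates adapted to the kernel of `J`, and after eliminating the components
weighted by `W₂₂`, the equation `(J f)' + H f = W k` becomes a differential system with invertible
leading coefficient and an algebraic equation,
`J₁ y' + A y = S (P k) + F (C k)` and `C f = M (C k) + G y` with `y = P f`,
while the weight becomes `⟨W f, g⟩ = ⟨S (P f), P g⟩ + ⟨C f, C g⟩`. The local index-1 hypotheses
give that `A` and `S` are locally integrable, `F` and `G` locally square integrable and `M`
locally bounded. Passing to the conjugate transpose of `H` replaces `A` and `M` by their conjugate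
transposes and exchanges `F` and `G` up to conjugate transposition. This is the structure
`Reduction`, and `exists_reduction` constructs it, both for invertible and for singular `J`.

*One inclusion.* If `f` is in the domain of `T₀` and `g` in that of `T`, integrating the derivative
of the boundary form `⟨J f, X (J g)⟩`, where `X` is the pseudoinverse of `J`, over an interval
outside which `J f` vanishes gives `⟨T₀ f, g⟩ = ⟨f, T g⟩` (`Reduction.inner_eq_inner`).

*The other inclusion.* Let `(g, h)` be in the adjoint relation of `T₀`. On a compact interval
`[a, b]` in the interior of `I`, take a particular solution of the adjoint system with right side
`h`, and subtract it from `g`. Let `e` be the component of the difference, cut off to `[a, b]`,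
orthogonal to the finite-dimensional space of homogeneous solutions. Solve `L f = e` on `[a, b]`
with `P f` vanishing at `a`. By orthogonality `P f` vanishes at `b` too, so that `f`, extended by
zero, lies in the domain of `T₀`; testing the relation against `f` yields `⟨e, e⟩ = 0`. Hence `g`
solves the adjoint system on `[a, b]` (`Reduction.exists_eq_solution_of_mem_adjoint`). The constants
of integration do not depend on the interval, so the solution property holds up to the endpoints
of `I` that belong to `I` (`Reduction.isDAImage_of_mem_adjoint`).
-/

/-! ### Adjoint pairs of unbounded operators -/

section OperatorTheory

variable {E : Type*} [NormedAddCommGroup E] [InnerProductSpace ℂ E]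

theorem Submodule.isClosed_adjoint (g : Submodule ℂ (E × E)) :
    IsClosed (g.adjoint : Set (E × E)) := by
  rw [Submodule.adjoint, Submodule.map_coe, LinearEquiv.coe_coe,
    LinearEquiv.image_eq_preimage_symm]
  exact (Submodule.isClosed_orthogonal _).preimage (WithLp.prod_continuous_toLp _ _ _)

theorem Submodule.adjoint_anti {g h : Submodule ℂ (E × E)} (hgh : g ≤ h) :
    h.adjoint ≤ g.adjoint := by
  intro x hx
  rw [Submodule.mem_adjoint_iff] at hx ⊢
  exact fun a b hab => hx a b (hgh hab)

theorem Submodule.le_adjoint_adjoint (g : Submodule ℂ (E × E)) : g ≤ g.adjoint.adjoint := by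
  rintro ⟨a, b⟩ hab
  rw [Submodule.mem_adjoint_iff]
  intro x y hxy
  have h := (Submodule.mem_adjoint_iff g (x, y)).mp hxy a b hab
  have h2 := congrArg (starRingEnd ℂ) h
  simp only [map_sub, inner_conj_symm, map_zero] at h2
  rw [← neg_sub, h2, neg_zero]

theorem Submodule.adjoint_adjoint_eq_topologicalClosure [CompleteSpace E]
    (g : Submodule ℂ (E × E)) : g.adjoint.adjoint = g.topologicalClosure := by
  refine le_antisymm ?_
    (Submodule.topologicalClosure_minimal _ g.le_adjoint_adjoint (Submodule.isClosed_adjoint _))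
  intro p hp
  let e : (E × E) ≃ₗ[ℂ] WithLp 2 (E × E) := (WithLp.linearEquiv 2 ℂ (E × E)).symm
  let K : Submodule ℂ (WithLp 2 (E × E)) := g.map e.toLinearMap
  have h1 : WithLp.toLp 2 p ∈ Kᗮᗮ := by
    rw [Submodule.mem_orthogonal]
    intro u hu
    rw [Submodule.mem_orthogonal] at hu
    -- `(u₁, u₂) ⊥ g` means that `(-u₂, u₁)` lies in the adjoint relation
    have h2 : (-(WithLp.ofLp u).2, (WithLp.ofLp u).1) ∈ g.adjoint := by
      rw [Submodule.mem_adjoint_iff]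
      intro a b hab
      have h3 := hu (WithLp.toLp 2 (a, b)) ⟨(a, b), hab, rfl⟩
      rw [WithLp.prod_inner_apply] at h3
      change inner ℂ a (WithLp.ofLp u).1 + inner ℂ b (WithLp.ofLp u).2 = 0 at h3
      simp only [inner_neg_right]
      linear_combination -h3
    have h4 := (Submodule.mem_adjoint_iff _ _).mp hp _ _ h2
    rw [WithLp.prod_inner_apply]
    change inner ℂ (WithLp.ofLp u).1 p.1 + inner ℂ (WithLp.ofLp u).2 p.2 = 0
    simpa only [inner_neg_left, sub_neg_eq_add] using h4
  rw [Submodule.orthogonal_orthogonal_eq_closure] at h1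
  have h5 : WithLp.toLp 2 p ∈ closure (WithLp.toLp 2 '' (g : Set (E × E))) := h1
  rw [← SetLike.mem_coe, Submodule.topologicalClosure_coe]
  have h6 := (image_closure_subset_closure_image
    (WithLp.prod_continuous_ofLp 2 E E)) (Set.mem_image_of_mem WithLp.ofLp h5)
  simpa [Set.image_image] using h6

namespace LinearPMap

variable {T S : E →ₗ.[ℂ] E}

theorem isClosed_of_graph_adjoint (h : T.graph.adjoint = S.graph) : S.IsClosed := by
  rw [IsClosed, ← h]
  exact Submodule.isClosed_adjoint _

theorem IsClosed.closure_eq (h : T.IsClosed) : T.closure = T := by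
  refine eq_of_eq_graph ?_
  rw [← h.isClosable.graph_closure_eq_closure_graph]
  exact h.submodule_topologicalClosure_eq

variable [CompleteSpace E]

/-- An operator whose adjoint relation is the graph of an operator is densely defined: a vector
`z` orthogonal to the domain gives the element `(0, z)` of the adjoint relation. -/
theorem dense_domain_of_graph_adjoint (h : T.graph.adjoint = S.graph) :
    Dense (T.domain : Set E) := by
  rw [Submodule.dense_iff_topologicalClosure_eq_top, Submodule.topologicalClosure_eq_top_iff,
    Submodule.eq_bot_iff]
  intro z hz
  have h1 : ((0 : E), z) ∈ S.graph := by
    rw [← h, Submodule.mem_adjoint_iff]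
    intro a b hab
    rw [hz a (LinearPMap.mem_domain_of_mem_graph hab)]
    simp
  exact S.graph_fst_eq_zero_snd h1 rfl

theorem adjoint_eq_of_graph_adjoint (h : T.graph.adjoint = S.graph) : T.adjoint = S :=
  eq_of_eq_graph (by rw [adjoint_graph_eq_graph_adjoint (dense_domain_of_graph_adjoint h), h])

theorem topologicalClosure_graph_eq (hT : Dense (T.domain : Set E))
    (hT' : Dense (T.adjoint.domain : Set E)) :
    T.graph.topologicalClosure = T.adjoint.adjoint.graph := by
  rw [adjoint_graph_eq_graph_adjoint hT', adjoint_graph_eq_graph_adjoint hT,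
    Submodule.adjoint_adjoint_eq_topologicalClosure]

theorem isClosable_of_dense_adjoint (hT : Dense (T.domain : Set E))
    (hT' : Dense (T.adjoint.domain : Set E)) : T.IsClosable :=
  ⟨_, topologicalClosure_graph_eq hT hT'⟩

theorem closure_eq_adjoint_adjoint (hT : Dense (T.domain : Set E))
    (hT' : Dense (T.adjoint.domain : Set E)) : T.closure = T.adjoint.adjoint :=
  eq_of_eq_graph (by
    rw [← (isClosable_of_dense_adjoint hT hT').graph_closure_eq_closure_graph,
      topologicalClosure_graph_eq hT hT'])

/-- The consequences of `T* = S` for a densely defined operator `S`. -/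
theorem adjoint_pair (h : T.graph.adjoint = S.graph) (hS : Dense (S.domain : Set E)) :
    S.IsClosed ∧ T.IsClosable ∧ T.closure = T.adjoint.adjoint ∧ T.adjoint = S ∧
      T.closure.adjoint = S ∧ S.closure = S ∧ S.adjoint.adjoint = S ∧ S.adjoint = T.closure := by
  have hT := dense_domain_of_graph_adjoint h
  have hTS := adjoint_eq_of_graph_adjoint h
  have hcl := isClosed_of_graph_adjoint h
  have hT' : Dense (T.adjoint.domain : Set E) := by rwa [hTS]
  have hcc := closure_eq_adjoint_adjoint hT hT'
  have hSA : S.adjoint = T.closure := by rw [hcc, hTS]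
  have hTc : T.closure.adjoint = S := by
    refine adjoint_eq_of_graph_adjoint ?_
    rw [hcc, ← topologicalClosure_graph_eq hT hT', ← h,
      ← Submodule.adjoint_adjoint_eq_topologicalClosure]
    refine le_antisymm (Submodule.adjoint_anti (Submodule.le_adjoint_adjoint _))
      (Submodule.le_adjoint_adjoint _)
  exact ⟨hcl, isClosable_of_dense_adjoint hT hT', hcc, hTS, hTc, hcl.closure_eq,
    by rw [hSA, hTc], hSA⟩

end LinearPMap

end OperatorTheory

/-! ### Absolutely continuous functions -/

section AbsolutelyContinuous

open Set Filter AbsolutelyContinuousOnInterval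

theorem AbsolutelyContinuousOnInterval.of_dist_le {X Y : Type*} [PseudoMetricSpace X]
    [PseudoMetricSpace Y] {f : ℝ → X} {g : ℝ → Y} {a b : ℝ} (K : ℝ)
    (hg : AbsolutelyContinuousOnInterval g a b)
    (h : ∀ x ∈ uIcc a b, ∀ y ∈ uIcc a b, dist (f x) (f y) ≤ K * dist (g x) (g y)) :
    AbsolutelyContinuousOnInterval f a b := by
  refine squeeze_zero' (Eventually.of_forall fun _ => Finset.sum_nonneg fun _ _ => dist_nonneg)
    ?_ (by simpa using Tendsto.const_mul K hg)
  rw [eventually_inf_principal]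
  refine Eventually.of_forall fun E hE => ?_
  rw [Finset.mul_sum]
  exact Finset.sum_le_sum fun i hi => h _ (hE.1 i hi).1 _ (hE.1 i hi).2

variable {F : Type*} [NormedAddCommGroup F] [NormedSpace ℝ F]

theorem IntervalIntegrable.absolutelyContinuousOnInterval_primitive {f : ℝ → F} {a b c : ℝ}
    (h : IntervalIntegrable f volume a b) (hc : c ∈ uIcc a b) :
    AbsolutelyContinuousOnInterval (fun x => ∫ t in c..x, f t) a b := by
  refine .of_dist_le 1 (h.norm.absolutelyContinuousOnInterval_intervalIntegral hc) ?_
  intro x hx y hy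
  have hi : ∀ z ∈ uIcc a b, IntervalIntegrable f volume c z := fun z hz =>
    h.mono_set (uIcc_subset_uIcc hc hz)
  rw [dist_eq_norm, dist_eq_norm, one_mul,
    intervalIntegral.integral_interval_sub_left (hi x hx) (hi y hy),
    intervalIntegral.integral_interval_sub_left (hi x hx).norm (hi y hy).norm, Real.norm_eq_abs]
  exact intervalIntegral.norm_integral_le_abs_integral_norm

theorem AbsolutelyContinuousOnInterval.integral_eq_sub [CompleteSpace F] {f v : ℝ → F} {a b : ℝ}
    (hf : AbsolutelyContinuousOnInterval f a b) (hv : IntervalIntegrable v volume a b)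
    (h : ∀ᵐ x, x ∈ uIcc a b → HasDerivAt f (v x) x) :
    ∫ x in a..b, v x = f b - f a := by
  have h1 := hf.fun_sub (hv.absolutelyContinuousOnInterval_primitive left_mem_uIcc)
  obtain ⟨C, hC⟩ := h1.const_of_ae_hasDerivAt_zero (by
    filter_upwards [h, hv.ae_hasDerivAt_integral] with x hx1 hx2 hx
    simpa using (hx1 hx).fun_sub (hx2 hx a left_mem_uIcc))
  have h2 := hC a left_mem_uIcc
  have h3 := hC b right_mem_uIcc
  simp only [intervalIntegral.integral_same, sub_zero] at h2 h3
  rw [h2, ← h3]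
  abel

/-- Integration of the derivative of `exp (2 φ)`, where `φ` is the primitive of `α`. -/
theorem setIntegral_Iic_mul_exp_le {α : ℝ → ℝ} (hα : Integrable α)
    (hint : Integrable fun s => α s * Real.exp (2 * ∫ x in Iic s, α x)) (t : ℝ) :
    ∫ s in Iic t, α s * Real.exp (2 * ∫ x in Iic s, α x) ≤
      Real.exp (2 * ∫ x in Iic t, α x) / 2 := by
  set φ : ℝ → ℝ := fun s => ∫ x in Iic s, α x with hφ
  refine le_of_tendsto (intervalIntegral_tendsto_integral_Iic t hint.integrableOn tendsto_id) ?_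
  filter_upwards [eventually_le_atBot t] with s hs
  simp only [id]
  have hφs : ∀ u, φ u = φ s + ∫ x in s..u, α x := fun u => by
    rw [← intervalIntegral.integral_Iic_sub_Iic hα.integrableOn hα.integrableOn]
    simp [hφ]
  have hac : AbsolutelyContinuousOnInterval φ s t := by
    refine .of_dist_le 1 (hα.intervalIntegrable.absolutelyContinuousOnInterval_primitive
      (left_mem_uIcc (a := s) (b := t))) fun x _ y _ => ?_
    rw [hφs x, hφs y, dist_add_left, one_mul]
  have hder : ∀ᵐ x, HasDerivAt φ (α x) x := by
    filter_upwards [LocallyIntegrable.ae_hasDerivAt_integral hα.locallyIntegrable] with x hx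
    rw [show φ = fun u => φ s + ∫ x in s..u, α x from funext hφs]
    exact (hx s).const_add _
  have hacE : AbsolutelyContinuousOnInterval (fun x => Real.exp (2 * φ x) / 2) s t := by
    obtain ⟨C, hC⟩ := hac.exists_bound
    have h1 : ContDiffOn ℝ 1 (fun z : ℝ => Real.exp (2 * z) / 2) (Icc (-C) C) := by fun_prop
    obtain ⟨K, hK⟩ := h1.exists_lipschitzOnWith (by decide) (convex_Icc _ _) isCompact_Icc
    refine .of_dist_le K hac fun x hx y hy => ?_
    exact hK.dist_le_mul _ (abs_le.mp (hC x hx)) _ (abs_le.mp (hC y hy))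
  rw [hacE.integral_eq_sub (v := fun s => α s * Real.exp (2 * φ s)) hint.intervalIntegrable]
  · have := Real.exp_pos (2 * φ s)
    linarith
  · filter_upwards [hder] with x hx _
    have := (hx.const_mul 2).exp.div_const 2
    rwa [show Real.exp (2 * φ x) * (2 * α x) / 2 = α x * Real.exp (2 * φ x) by ring] at this

end AbsolutelyContinuous

/-! ### Linear differential equations with integrable coefficients -/

section LinearODE

open Set Filter
open scoped BoundedContinuousFunction

variable {m : ℕ}

theorem norm_mulVec_le_sum {k : ℕ} (A : Matrix (Fin m) (Fin k) ℂ) (y : Fin k → ℂ) :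
    ‖A *ᵥ y‖ ≤ (∑ i, ∑ j, ‖A i j‖) * ‖y‖ := by
  refine (pi_norm_le_iff_of_nonneg (by positivity)).mpr fun i => ?_
  calc ‖(A *ᵥ y) i‖ ≤ ∑ j, ‖A i j‖ * ‖y j‖ := by
        refine (norm_sum_le Finset.univ fun j => A i j * y j).trans (le_of_eq ?_)
        simp
    _ ≤ ∑ j, ‖A i j‖ * ‖y‖ := by gcongr with j; exact norm_le_pi_norm y j
    _ ≤ (∑ i, ∑ j, ‖A i j‖) * ‖y‖ := by
        rw [← Finset.sum_mul]
        gcongr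
        exact Finset.single_le_sum (f := fun i => ∑ j, ‖A i j‖)
          (fun _ _ => Finset.sum_nonneg fun _ _ => norm_nonneg _) (Finset.mem_univ i)

theorem aestronglyMeasurable_mulVec_fun {k : ℕ} {μ : Measure ℝ}
    {A : ℝ → Matrix (Fin m) (Fin k) ℂ}
    (hA : ∀ i j, AEStronglyMeasurable (fun t => A t i j) μ) {f : ℝ → Fin k → ℂ}
    (hf : AEStronglyMeasurable f μ) : AEStronglyMeasurable (fun t => A t *ᵥ f t) μ := by
  refine (aemeasurable_pi_lambda _ fun i => ?_).aestronglyMeasurable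
  refine AEStronglyMeasurable.aemeasurable (f := fun t => ∑ j, A t i j * f t j) ?_
  refine Finset.aestronglyMeasurable_fun_sum _ fun j _ => (hA i j).mul ?_
  exact (continuous_apply j).comp_aestronglyMeasurable hf

theorem integrable_mulVec_of_bounded {k : ℕ} {μ : Measure ℝ} {A : ℝ → Matrix (Fin m) (Fin k) ℂ}
    (hA : ∀ i j, Integrable (fun t => A t i j) μ) {f : ℝ → Fin k → ℂ}
    (hf : AEStronglyMeasurable f μ) {K : ℝ} (hK : ∀ᵐ t ∂μ, ‖f t‖ ≤ K) :
    Integrable (fun t => A t *ᵥ f t) μ := by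
  have h1 : Integrable (fun t => (∑ i, ∑ j, ‖A t i j‖) * K) μ :=
    (integrable_finsetSum _ fun i _ => integrable_finsetSum _ fun j _ =>
      (hA i j).norm).mul_const K
  refine h1.mono' (aestronglyMeasurable_mulVec_fun (fun i j => (hA i j).aestronglyMeasurable) hf) ?_
  filter_upwards [hK] with t ht
  exact (norm_mulVec_le_sum _ _).trans (by gcongr)

theorem Integrable.continuous_setIntegral_Iic {F : Type*} [NormedAddCommGroup F]
    [NormedSpace ℝ F] {f : ℝ → F} (hf : Integrable f) :
    Continuous fun t => ∫ s in Iic t, f s := by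
  have h : (fun t => ∫ s in Iic t, f s) =
      fun t => (∫ s in Iic (0 : ℝ), f s) + ∫ s in (0 : ℝ)..t, f s := by
    funext t
    rw [← intervalIntegral.integral_Iic_sub_Iic hf.integrableOn hf.integrableOn]
    simp
  rw [h]
  exact continuous_const.add
    (intervalIntegral.continuous_primitive (fun _ _ => hf.intervalIntegrable) 0)

/-- Global solvability of `y' = A y + q` with integrable coefficients and prescribed value at
`-∞`: the integral operator is a contraction in the weighted supremum norm with weight
`exp (-2 ∫_{-∞}^t ‖A‖)`. -/
theorem exists_eq_add_setIntegral_Iic {A : ℝ → Matrix (Fin m) (Fin m) ℂ} {q : ℝ → Fin m → ℂ}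
    (hA : ∀ i j, Integrable fun t => A t i j) (hq : Integrable q) (c : Fin m → ℂ) :
    ∃ y : ℝ → Fin m → ℂ, Continuous y ∧ Integrable (fun s => A s *ᵥ y s + q s) ∧
      ∀ t, y t = c + ∫ s in Iic t, (A s *ᵥ y s + q s) := by
  set α : ℝ → ℝ := fun s => ∑ i, ∑ j, ‖A s i j‖ with hα_def
  have hα0 : ∀ s, 0 ≤ α s := fun s => by positivity
  have hα : Integrable α :=
    integrable_finsetSum _ fun i _ => integrable_finsetSum _ fun j _ => (hA i j).norm
  set ρ : ℝ → ℝ := fun t => Real.exp (2 * ∫ x in Iic t, α x) with hρ_def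
  have hρc : Continuous ρ := by
    have := Integrable.continuous_setIntegral_Iic hα
    fun_prop
  have hρ1 : ∀ t, 1 ≤ ρ t := fun t => Real.one_le_exp
    (mul_nonneg two_pos.le (integral_nonneg hα0))
  have hρ0 : ∀ t, 0 < ρ t := fun t => Real.exp_pos _
  have hρb : ∀ t, ρ t ≤ Real.exp (2 * ∫ x, α x) := fun t => by
    refine Real.exp_le_exp.mpr (mul_le_mul_of_nonneg_left ?_ two_pos.le)
    exact setIntegral_le_integral hα (Eventually.of_forall hα0)
  have hαρ : Integrable fun s => α s * ρ s :=
    hα.mul_bdd (c := Real.exp (2 * ∫ x, α x)) hρc.aestronglyMeasurable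
      (Eventually.of_forall fun t => by
        rw [Real.norm_of_nonneg (hρ0 t).le]; exact hρb t)
  have hint : ∀ z : ℝ →ᵇ (Fin m → ℂ), Integrable fun s => A s *ᵥ (ρ s • z s) := fun z => by
    refine integrable_mulVec_of_bounded hA (hρc.smul z.continuous).aestronglyMeasurable
      (K := Real.exp (2 * ∫ x, α x) * ‖z‖) (Eventually.of_forall fun t => ?_)
    rw [norm_smul, Real.norm_of_nonneg (hρ0 t).le]
    gcongr
    · exact hρb t
    · exact z.norm_coe_le_norm t
  let T : (ℝ →ᵇ (Fin m → ℂ)) → (ℝ →ᵇ (Fin m → ℂ)) := fun z =>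
    BoundedContinuousFunction.ofNormedAddCommGroup
      (fun t => (ρ t)⁻¹ • (c + ∫ s in Iic t, (A s *ᵥ (ρ s • z s) + q s)))
      ((hρc.inv₀ fun t => (hρ0 t).ne').smul
        (continuous_const.add (Integrable.continuous_setIntegral_Iic ((hint z).add hq))))
      (‖c‖ + ∫ s, ‖A s *ᵥ (ρ s • z s) + q s‖) (fun t => by
        rw [norm_smul, norm_inv, Real.norm_of_nonneg (hρ0 t).le]
        have h1 : ‖c + ∫ s in Iic t, (A s *ᵥ (ρ s • z s) + q s)‖ ≤
            ‖c‖ + ∫ s, ‖A s *ᵥ (ρ s • z s) + q s‖ := by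
          refine (norm_add_le _ _).trans (add_le_add le_rfl ?_)
          refine (norm_integral_le_integral_norm _).trans ?_
          exact setIntegral_le_integral ((hint z).add hq).norm
            (Eventually.of_forall fun _ => norm_nonneg _)
        calc (ρ t)⁻¹ * _ ≤ 1 * _ := by
              gcongr
              exact inv_le_one_of_one_le₀ (hρ1 t)
          _ ≤ _ := by rwa [one_mul])
  have hT : ContractingWith (1 / 2) T := by
    refine ⟨by rw [← NNReal.coe_lt_coe]; norm_num, LipschitzWith.of_dist_le_mul fun z w => ?_⟩
    refine (BoundedContinuousFunction.dist_le (by positivity)).mpr fun t => ?_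
    have h1 : T z t - T w t = (ρ t)⁻¹ • ∫ s in Iic t, A s *ᵥ (ρ s • (z s - w s)) := by
      change (ρ t)⁻¹ • (c + ∫ s in Iic t, (A s *ᵥ (ρ s • z s) + q s)) -
        (ρ t)⁻¹ • (c + ∫ s in Iic t, (A s *ᵥ (ρ s • w s) + q s)) = _
      have hi : ∀ z : ℝ →ᵇ (Fin m → ℂ), IntegrableOn (fun s => A s *ᵥ (ρ s • z s) + q s) (Iic t) :=
        fun z => ((hint z).add hq).integrableOn
      rw [← smul_sub, add_sub_add_left_eq_sub, ← integral_sub (hi z) (hi w)]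
      congr 2
      funext s
      rw [smul_sub, mulVec_sub]
      simp
    rw [dist_eq_norm, h1, norm_smul, norm_inv, Real.norm_of_nonneg (hρ0 t).le]
    have h2 : ‖∫ s in Iic t, A s *ᵥ (ρ s • (z s - w s))‖ ≤
        ∫ s in Iic t, (α s * ρ s) * dist z w := by
      refine norm_integral_le_of_norm_le (hαρ.mul_const _).integrableOn
        (Eventually.of_forall fun s => ?_)
      refine (norm_mulVec_le_sum _ _).trans ?_
      rw [norm_smul, Real.norm_of_nonneg (hρ0 s).le, ← mul_assoc, ← dist_eq_norm]
      exact mul_le_mul_of_nonneg_left (BoundedContinuousFunction.dist_coe_le_dist s)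
        (mul_nonneg (hα0 s) (hρ0 s).le)
    rw [integral_mul_const] at h2
    have h3 := setIntegral_Iic_mul_exp_le hα hαρ t
    have h4 := h2.trans (mul_le_mul_of_nonneg_right h3 dist_nonneg)
    calc (ρ t)⁻¹ * _ ≤ (ρ t)⁻¹ * (ρ t / 2 * dist z w) := by
          have := (hρ0 t).le
          gcongr
      _ = _ := by
          have := (hρ0 t).ne'
          push_cast
          field_simp
  have hfix : T hT.fixedPoint = hT.fixedPoint := hT.fixedPoint_isFixedPt
  set z := hT.fixedPoint
  refine ⟨fun t => ρ t • z t, hρc.smul z.continuous, (hint z).add hq, fun t => ?_⟩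
  have h5 : (ρ t)⁻¹ • (c + ∫ s in Iic t, (A s *ᵥ (ρ s • z s) + q s)) = z t :=
    congrArg (fun f : ℝ →ᵇ (Fin m → ℂ) => f t) hfix
  change ρ t • z t = _
  rw [← h5, smul_smul, mul_inv_cancel₀ (hρ0 t).ne', one_smul]

/-- Solution of the initial value problem `y' = A y + q`, `y(a) = c` on `[a, b]`; the solution
is extended to the line by constants, and `r` is its derivative. -/
theorem exists_solution_on_Icc {a b : ℝ} {A : ℝ → Matrix (Fin m) (Fin m) ℂ} {q : ℝ → Fin m → ℂ}
    (hA : ∀ i j, IntegrableOn (fun t => A t i j) (Icc a b)) (hq : IntegrableOn q (Icc a b))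
    (c : Fin m → ℂ) :
    ∃ y r : ℝ → Fin m → ℂ, Continuous y ∧ Integrable r ∧ (∀ t, y t = c + ∫ s in a..t, r s) ∧
      (∀ t ∈ Icc a b, r t = A t *ᵥ y t + q t) ∧ ∀ t ∉ Icc a b, r t = 0 := by
  obtain ⟨y, hy, hr, h⟩ := exists_eq_add_setIntegral_Iic
    (A := (Icc a b).indicator A) (q := (Icc a b).indicator q) (fun i j => by
      refine ((hA i j).integrable_indicator measurableSet_Icc).congr
        (Eventually.of_forall fun t => ?_)
      by_cases ht : t ∈ Icc a b <;> simp [ht]) (hq.integrable_indicator measurableSet_Icc) c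
  refine ⟨y, _, hy, hr, fun t => ?_, fun t ht => by simp [ht], fun t ht => by simp [ht]⟩
  rw [h t, ← intervalIntegral.integral_Iic_sub_Iic hr.integrableOn hr.integrableOn]
  have h0 : ∫ s in Iic a, ((Icc a b).indicator A s *ᵥ y s + (Icc a b).indicator q s) = 0 := by
    rw [integral_Iic_eq_integral_Iio]
    refine setIntegral_eq_zero_of_forall_eq_zero fun s hs => ?_
    have : s ∉ Icc a b := fun hs' => absurd hs'.1 (not_le.mpr hs)
    simp [this]
  rw [h0, sub_zero]

end LinearODE

/-! ### Integrability of matrix-vector products -/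

section MatrixVector

open Set
open scoped ENNReal

variable {l m k : ℕ} {μ : Measure ℝ} {p q r : ℝ≥0∞}

theorem memLp_mulVec [ENNReal.HolderTriple p q r] {A : ℝ → Matrix (Fin m) (Fin k) ℂ}
    {f : ℝ → Fin k → ℂ} (hA : ∀ i j, MemLp (fun t => A t i j) p μ) (hf : MemLp f q μ) :
    MemLp (fun t => A t *ᵥ f t) r μ := by
  refine memLp_pi_iff.mpr fun i => ?_
  change MemLp (fun t => ∑ j, A t i j * f t j) r μ
  exact memLp_finsetSum _ fun j _ => (memLp_pi_iff.mp hf j).mul' (hA i j)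

theorem integrable_star_dotProduct [ENNReal.HolderTriple p q 1] {f g : ℝ → Fin k → ℂ}
    (hf : MemLp f p μ) (hg : MemLp g q μ) : Integrable (fun t => star (f t) ⬝ᵥ g t) μ := by
  change Integrable (fun t => ∑ j, star (f t j) * g t j) μ
  exact integrable_finsetSum _ fun j _ =>
    memLp_one_iff_integrable.mp ((memLp_pi_iff.mp hg j).mul' (memLp_pi_iff.mp hf j).star)

theorem Continuous.memLp_top_Icc {f : ℝ → Fin k → ℂ} (hf : Continuous f) (a b : ℝ) :
    MemLp f ∞ (volume.restrict (Icc a b)) := by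
  obtain ⟨C, hC⟩ := isCompact_Icc.exists_bound_of_continuousOn (s := Icc a b) hf.continuousOn
  exact memLp_top_of_bound hf.aestronglyMeasurable C
    ((ae_restrict_iff' measurableSet_Icc).mpr (Filter.Eventually.of_forall hC))

theorem aestronglyMeasurable_matrix {A : ℝ → Matrix (Fin m) (Fin k) ℂ}
    (hA : ∀ i j, AEStronglyMeasurable (fun t => A t i j) μ) : AEStronglyMeasurable A μ := by
  have h1 : AEMeasurable (fun t => fun i j => A t i j) μ :=
    aemeasurable_pi_lambda _ fun i => aemeasurable_pi_lambda _ fun j => (hA i j).aemeasurable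
  exact h1.aestronglyMeasurable

theorem aestronglyMeasurable_entry {A : ℝ → Matrix (Fin m) (Fin k) ℂ}
    (hA : AEStronglyMeasurable A μ) (i : Fin m) (j : Fin k) :
    AEStronglyMeasurable (fun t => A t i j) μ :=
  (show Continuous fun B : Matrix (Fin m) (Fin k) ℂ => B i j by fun_prop).comp_aestronglyMeasurable
    hA

theorem aestronglyMeasurable_matrix_mul {A : ℝ → Matrix (Fin l) (Fin m) ℂ}
    {B : ℝ → Matrix (Fin m) (Fin k) ℂ} (hA : AEStronglyMeasurable A μ)
    (hB : AEStronglyMeasurable B μ) : AEStronglyMeasurable (fun t => A t * B t) μ :=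
  (show Continuous fun p : Matrix (Fin l) (Fin m) ℂ × Matrix (Fin m) (Fin k) ℂ => p.1 * p.2 by
    fun_prop).comp_aestronglyMeasurable (hA.prodMk hB)

theorem aestronglyMeasurable_matrix_inv {A : ℝ → Matrix (Fin m) (Fin m) ℂ}
    (hA : AEStronglyMeasurable A μ) : AEStronglyMeasurable (fun t => (A t)⁻¹) μ := by
  have h1 : Continuous fun B : Matrix (Fin m) (Fin m) ℂ => B.det := by fun_prop
  have h2 : Continuous fun B : Matrix (Fin m) (Fin m) ℂ => B.adjugate := by fun_prop
  have h3 := ((h1.comp_aestronglyMeasurable hA).aemeasurable.inv).aestronglyMeasurable.smul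
    (h2.comp_aestronglyMeasurable hA)
  refine h3.congr (Filter.Eventually.of_forall fun t => ?_)
  simp [Matrix.inv_def]

end MatrixVector

/-! ### Reduced form of the system -/

section Reduced

variable {n : ℕ} {I : Set ℝ}

theorem Weight.L2.integrable_innerAt {W : Weight n I} (f g : W.L2) :
    Integrable (fun t => W.innerAt t (f t) (g t)) (volume.restrict I) := by
  refine (MeasureTheory.L2.integrable_inner (𝕜 := ℂ) (toLp W f) (toLp W g)).congr ?_
  filter_upwards [W.posSemidef, f.memLp.coeFn_toLp, g.memLp.coeFn_toLp] with t h1 h2 h3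
  rw [W.innerAt_eq h1, ← h2, ← h3]
  rfl

/-- Coordinates `y = P f ∈ ℂ^{n₁}`, `η = C(t) f ∈ ℂ^{n₂}` of `f ∈ ℂⁿ`, with inverse
`f = E(t) y + D(t) η`, in which the system `(J f)' + H f = W k` takes the reduced form
`J₁ y' + A y = S z + F ζ`, `η = M ζ + G y`, where `z = P k` and `ζ = C k`, and in which
`⟨W f, k⟩ = ⟨S y, z⟩ + ⟨η, ζ⟩`. The first equation is a differential equation with locally
integrable coefficients; the second expresses `η` explicitly. The matrix `N` is the inverse
of `M`. -/
structure Reduction (W : Weight n I) (J : Matrix (Fin n) (Fin n) ℂ)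
    (H : ℝ → Matrix (Fin n) (Fin n) ℂ) (n₁ n₂ : ℕ) where
  J₁ : Matrix (Fin n₁) (Fin n₁) ℂ
  P : Matrix (Fin n₁) (Fin n) ℂ
  C : ℝ → Matrix (Fin n₂) (Fin n) ℂ
  E : ℝ → Matrix (Fin n) (Fin n₁) ℂ
  D : ℝ → Matrix (Fin n) (Fin n₂) ℂ
  S : ℝ → Matrix (Fin n₁) (Fin n₁) ℂ
  A : ℝ → Matrix (Fin n₁) (Fin n₁) ℂ
  F : ℝ → Matrix (Fin n₁) (Fin n₂) ℂ
  G : ℝ → Matrix (Fin n₂) (Fin n₁) ℂ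
  M : ℝ → Matrix (Fin n₂) (Fin n₂) ℂ
  N : ℝ → Matrix (Fin n₂) (Fin n₂) ℂ
  isUnit_J₁ : IsUnit J₁.det
  J₁_skew : J₁ᴴ = -J₁
  J_eq : J = Pᴴ * J₁ * P
  P_mul : P * Pᴴ = 1
  P_E : ∀ᵐ t ∂volume.restrict I, P * E t = 1
  P_D : ∀ᵐ t ∂volume.restrict I, P * D t = 0
  C_E : ∀ᵐ t ∂volume.restrict I, C t * E t = 0
  C_D : ∀ᵐ t ∂volume.restrict I, C t * D t = 1
  E_P : ∀ᵐ t ∂volume.restrict I, E t * P + D t * C t = 1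
  W_eq : ∀ᵐ t ∂volume.restrict I, W.toFun t = Pᴴ * S t * P + (C t)ᴴ * C t
  H_eq : ∀ᵐ t ∂volume.restrict I,
    H t = Pᴴ * A t * P + ((C t)ᴴ - Pᴴ * F t) * N t * (C t - G t * P)
  N_M : ∀ᵐ t ∂volume.restrict I, N t * M t = 1
  C_meas : ∀ i j, AEStronglyMeasurable (fun t => C t i j) (volume.restrict I)
  E_meas : ∀ i j, AEStronglyMeasurable (fun t => E t i j) (volume.restrict I)
  D_meas : ∀ i j, AEStronglyMeasurable (fun t => D t i j) (volume.restrict I)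
  S_loc : MatMemLpLoc 1 I S
  A_loc : MatMemLpLoc 1 I A
  F_loc : MatMemLpLoc 2 I F
  G_loc : MatMemLpLoc 2 I G
  M_loc : MatMemLpLoc ⊤ I M

theorem MatMemLpLoc.conjTranspose {p : ENNReal} {k m : ℕ} {A : ℝ → Matrix (Fin k) (Fin m) ℂ}
    (hA : MatMemLpLoc p I A) : MatMemLpLoc p I fun t => (A t)ᴴ := fun i j =>
  ⟨(hA j i).1.star, fun a b hab => ((hA j i).2 a b hab).star⟩

theorem MatMemLpLoc.memLp {p : ENNReal} {k m : ℕ} {A : ℝ → Matrix (Fin k) (Fin m) ℂ}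
    (hA : MatMemLpLoc p I A) {a b : ℝ} (hab : Set.Icc a b ⊆ I) (i : Fin k) (j : Fin m) :
    MemLp (fun t => A t i j) p (volume.restrict (Set.Icc a b)) := (hA i j).2 a b hab

namespace Reduction

variable {W : Weight n I} {J : Matrix (Fin n) (Fin n) ℂ} {H : ℝ → Matrix (Fin n) (Fin n) ℂ}
  {n₁ n₂ : ℕ}

/-- The adjoint coefficients: the same coordinates reduce the system with `H^*` in place of
`H`, with `A`, `M` replaced by their adjoints and `F`, `G` by `G^*`, `F^*`. -/
def adjoint (ρ : Reduction W J H n₁ n₂) : Reduction W J (fun t => (H t)ᴴ) n₁ n₂ where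
  __ := ρ
  A := fun t => (ρ.A t)ᴴ
  F := fun t => (ρ.G t)ᴴ
  G := fun t => (ρ.F t)ᴴ
  M := fun t => (ρ.M t)ᴴ
  N := fun t => (ρ.N t)ᴴ
  H_eq := by
    filter_upwards [ρ.H_eq] with t ht
    rw [ht]
    simp only [conjTranspose_add, conjTranspose_mul, conjTranspose_sub,
      conjTranspose_conjTranspose, Matrix.mul_assoc]
  N_M := by
    filter_upwards [ρ.N_M] with t ht
    rw [← conjTranspose_mul, mul_eq_one_comm.mp ht, conjTranspose_one]
  A_loc := ρ.A_loc.conjTranspose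
  F_loc := ρ.G_loc.conjTranspose
  G_loc := ρ.F_loc.conjTranspose
  M_loc := ρ.M_loc.conjTranspose

variable (ρ : Reduction W J H n₁ n₂)

/-- The reduced form of `Pᴴ r + H f = W k`, where `Pᴴ r` stands for `(J f)'` and `r` for
`J₁ (P f)'`. Since `[P; C]ᴴ` is invertible, the equation amounts to the equality of the
coefficients of `Pᴴ` and `Cᴴ`. -/
theorem equation_iff : ∀ᵐ t ∂volume.restrict I, ∀ (r : Fin n₁ → ℂ) (f k : Fin n → ℂ),
    ρ.Pᴴ *ᵥ r + H t *ᵥ f = W.toFun t *ᵥ k ↔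
      r + ρ.A t *ᵥ (ρ.P *ᵥ f) = ρ.S t *ᵥ (ρ.P *ᵥ k) + ρ.F t *ᵥ (ρ.C t *ᵥ k) ∧
      ρ.C t *ᵥ f = ρ.M t *ᵥ (ρ.C t *ᵥ k) + ρ.G t *ᵥ (ρ.P *ᵥ f) := by
  filter_upwards [ρ.P_E, ρ.P_D, ρ.C_E, ρ.C_D, ρ.W_eq, ρ.H_eq, ρ.N_M] with
    t hPE hPD hCE hCD hW hH hNM r f k
  have hMN := mul_eq_one_comm.mp hNM
  have hEP : (ρ.E t)ᴴ * ρ.Pᴴ = 1 := by rw [← conjTranspose_mul, hPE, conjTranspose_one]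
  have hDP : (ρ.D t)ᴴ * ρ.Pᴴ = 0 := by rw [← conjTranspose_mul, hPD, conjTranspose_zero]
  have hEC : (ρ.E t)ᴴ * (ρ.C t)ᴴ = 0 := by rw [← conjTranspose_mul, hCE, conjTranspose_zero]
  have hDC : (ρ.D t)ᴴ * (ρ.C t)ᴴ = 1 := by rw [← conjTranspose_mul, hCD, conjTranspose_one]
  set y := ρ.P *ᵥ f
  set z := ρ.P *ᵥ k
  set η := ρ.C t *ᵥ f
  set ζ := ρ.C t *ᵥ k
  set ω := ρ.N t *ᵥ (η - ρ.G t *ᵥ y) with hω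
  have h1 : H t *ᵥ f = ρ.Pᴴ *ᵥ (ρ.A t *ᵥ y - ρ.F t *ᵥ ω) + (ρ.C t)ᴴ *ᵥ ω := by
    have h2 : (ρ.C t - ρ.G t * ρ.P) *ᵥ f = η - ρ.G t *ᵥ y := by
      rw [sub_mulVec, mulVec_mulVec]
    rw [hH, add_mulVec, ← mulVec_mulVec, ← mulVec_mulVec, ← mulVec_mulVec _ _ (_ - _), h2,
      ← mulVec_mulVec, ← hω, sub_mulVec, ← mulVec_mulVec, mulVec_sub]
    abel
  have h3 : W.toFun t *ᵥ k = ρ.Pᴴ *ᵥ (ρ.S t *ᵥ z) + (ρ.C t)ᴴ *ᵥ ζ := by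
    rw [hW, add_mulVec, ← mulVec_mulVec, ← mulVec_mulVec, ← mulVec_mulVec]
  have hEx : ∀ x u, (ρ.E t)ᴴ *ᵥ (ρ.Pᴴ *ᵥ x + (ρ.C t)ᴴ *ᵥ u) = x := fun x u => by
    rw [mulVec_add, mulVec_mulVec, mulVec_mulVec, hEP, hEC, one_mulVec, zero_mulVec, add_zero]
  have hDx : ∀ x u, (ρ.D t)ᴴ *ᵥ (ρ.Pᴴ *ᵥ x + (ρ.C t)ᴴ *ᵥ u) = u := fun x u => by
    rw [mulVec_add, mulVec_mulVec, mulVec_mulVec, hDP, hDC, one_mulVec, zero_mulVec, zero_add]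
  rw [h1, h3]
  constructor
  · intro h
    rw [← add_assoc, ← mulVec_add] at h
    have hE := congrArg (fun x => (ρ.E t)ᴴ *ᵥ x) h
    have hD := congrArg (fun x => (ρ.D t)ᴴ *ᵥ x) h
    simp only [hEx, hDx] at hE hD
    refine ⟨?_, ?_⟩
    · rw [hD] at hE
      rw [← hE]
      abel
    · have := congrArg (fun x => ρ.M t *ᵥ x) hD
      simp only [hω, mulVec_mulVec _ (ρ.M t) (ρ.N t), hMN, one_mulVec] at this
      exact eq_add_of_sub_eq this
  · rintro ⟨ha, hb⟩
    have hωζ : ω = ζ := by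
      rw [hω, hb, add_sub_cancel_right, mulVec_mulVec, hNM, one_mulVec]
    rw [hωζ, ← add_assoc, ← mulVec_add]
    congr 2
    rw [← add_sub_assoc, ha]
    abel

theorem innerAt_eq : ∀ᵐ t ∂volume.restrict I, ∀ f k : Fin n → ℂ,
    W.innerAt t f k = star (ρ.S t *ᵥ (ρ.P *ᵥ f)) ⬝ᵥ (ρ.P *ᵥ k) +
      star (ρ.C t *ᵥ f) ⬝ᵥ (ρ.C t *ᵥ k) := by
  filter_upwards [ρ.W_eq] with t hW f k
  rw [Weight.innerAt, hW, add_mulVec, star_add, add_dotProduct, ← mulVec_mulVec,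
    ← mulVec_mulVec, ← mulVec_mulVec, star_mulVec ρ.Pᴴ, star_mulVec (ρ.C t)ᴴ,
    conjTranspose_conjTranspose, conjTranspose_conjTranspose, dotProduct_mulVec,
    dotProduct_mulVec]

theorem S_posSemidef : ∀ᵐ t ∂volume.restrict I, (ρ.S t).PosSemidef := by
  filter_upwards [ρ.W_eq, ρ.P_E, ρ.C_E, W.posSemidef] with t hW hPE hCE hpos
  have h := hpos.conjTranspose_mul_mul_same (ρ.E t)
  have h1 : (ρ.E t)ᴴ * ρ.Pᴴ = 1 := by rw [← conjTranspose_mul, hPE, conjTranspose_one]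
  have h2 : (ρ.E t)ᴴ * W.toFun t * ρ.E t = ρ.S t := by
    rw [hW]
    calc _ = ((ρ.E t)ᴴ * ρ.Pᴴ) * ρ.S t * (ρ.P * ρ.E t) +
          (ρ.E t)ᴴ * (ρ.C t)ᴴ * (ρ.C t * ρ.E t) := by
          simp only [Matrix.mul_add, Matrix.add_mul, Matrix.mul_assoc]
      _ = _ := by rw [h1, hPE, hCE]; simp
  rwa [h2] at h

/-- Functions on `[a, b]`, the first one continuous and the second one square integrable, are the
coordinates of an element of `L²(I; W)` vanishing outside `[a, b]`. -/
theorem exists_of_coordinates {a b : ℝ} (hab : Set.Icc a b ⊆ I) {w : ℝ → Fin n₁ → ℂ}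
    (hw : Continuous w) {θ : ℝ → Fin n₂ → ℂ} (hθ : MemLp θ 2 (volume.restrict (Set.Icc a b))) :
    ∃ f : W.L2, ∀ᵐ t ∂volume.restrict I, ρ.P *ᵥ f t = (Set.Icc a b).indicator w t ∧
      ρ.C t *ᵥ f t = (Set.Icc a b).indicator θ t := by
  have hμ : (volume.restrict I).restrict (Set.Icc a b) = volume.restrict (Set.Icc a b) := by
    rw [Measure.restrict_restrict measurableSet_Icc, Set.inter_eq_left.mpr hab]
  have hwm : AEStronglyMeasurable ((Set.Icc a b).indicator w) (volume.restrict I) :=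
    hw.aestronglyMeasurable.indicator measurableSet_Icc
  have hθm : AEStronglyMeasurable ((Set.Icc a b).indicator θ) (volume.restrict I) := by
    rw [aestronglyMeasurable_indicator_iff measurableSet_Icc, hμ]
    exact hθ.1
  set f₀ : ℝ → Fin n → ℂ := fun t =>
    ρ.E t *ᵥ (Set.Icc a b).indicator w t + ρ.D t *ᵥ (Set.Icc a b).indicator θ t with hf₀
  have hf₀m : AEStronglyMeasurable f₀ (volume.restrict I) :=
    (aestronglyMeasurable_mulVec_fun ρ.E_meas hwm).add
      (aestronglyMeasurable_mulVec_fun ρ.D_meas hθm)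
  have hco : ∀ᵐ t ∂volume.restrict I, ρ.P *ᵥ f₀ t = (Set.Icc a b).indicator w t ∧
      ρ.C t *ᵥ f₀ t = (Set.Icc a b).indicator θ t := by
    filter_upwards [ρ.P_E, ρ.P_D, ρ.C_E, ρ.C_D] with t h1 h2 h3 h4
    simp [hf₀, mulVec_add, mulVec_mulVec, h1, h2, h3, h4]
  have hint : Integrable (fun t => W.innerAt t (f₀ t) (f₀ t)) (volume.restrict I) := by
    have h1 : Integrable (fun t => star (ρ.S t *ᵥ w t) ⬝ᵥ w t + star (θ t) ⬝ᵥ θ t)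
        (volume.restrict (Set.Icc a b)) := by
      have hS : MemLp (fun t => ρ.S t *ᵥ w t) 1 (volume.restrict (Set.Icc a b)) :=
        memLp_mulVec (ρ.S_loc.memLp hab) (hw.memLp_top_Icc a b)
      exact (integrable_star_dotProduct hS (hw.memLp_top_Icc a b)).add
        (integrable_star_dotProduct hθ hθ)
    rw [← hμ] at h1
    refine (IntegrableOn.integrable_indicator h1 measurableSet_Icc).congr ?_
    filter_upwards [hco, ρ.innerAt_eq] with t h2 h3
    rw [h3, h2.1, h2.2]
    by_cases ht : t ∈ Set.Icc a b <;> simp [ht]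
  have hae : AEEqFun.mk f₀ hf₀m =ᵐ[volume.restrict I] f₀ := AEEqFun.coeFn_mk _ _
  refine ⟨⟨AEEqFun.mk f₀ hf₀m, hint.congr ?_⟩, ?_⟩
  · filter_upwards [hae] with t ht
    rw [ht]
  · filter_upwards [hae, hco] with t ht h2
    change ρ.P *ᵥ (AEEqFun.mk f₀ hf₀m : ℝ → Fin n → ℂ) t = _ ∧
      ρ.C t *ᵥ (AEEqFun.mk f₀ hf₀m : ℝ → Fin n → ℂ) t = _
    rwa [ht]

/-- The second coordinate is square integrable, as `⟨W f, f⟩` dominates `|C f|²`. -/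
theorem memLp_C (f : W.L2) : MemLp (fun t => ρ.C t *ᵥ f t) 2 (volume.restrict I) := by
  have hm := aestronglyMeasurable_mulVec_fun ρ.C_meas f.aestronglyMeasurable
  refine memLp_pi_iff.mpr fun i => ?_
  have hmi := (continuous_apply i).comp_aestronglyMeasurable hm
  refine (memLp_two_iff_integrable_sq_norm hmi).mpr ?_
  refine (f.integrable_innerAt f).norm.mono' (hmi.norm.pow 2) ?_
  filter_upwards [ρ.innerAt_eq, ρ.S_posSemidef] with t h1 h2
  have h3 := h2.re_dotProduct_nonneg (ρ.P *ᵥ f t)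
  have h4 : star (ρ.S t *ᵥ (ρ.P *ᵥ f t)) ⬝ᵥ (ρ.P *ᵥ f t) =
      star (ρ.P *ᵥ f t) ⬝ᵥ (ρ.S t *ᵥ (ρ.P *ᵥ f t)) := by
    rw [star_mulVec, h2.isHermitian.eq, dotProduct_mulVec _ (ρ.S t)]
  have h5 : (star (ρ.C t *ᵥ f t) ⬝ᵥ (ρ.C t *ᵥ f t)).re = ∑ j, ‖(ρ.C t *ᵥ f t) j‖ ^ 2 := by
    rw [dotProduct, Complex.re_sum]
    refine Finset.sum_congr rfl fun j _ => ?_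
    rw [Pi.star_apply, Complex.star_def, Complex.conj_mul', ← Complex.ofReal_pow,
      Complex.ofReal_re]
  have h6 : ‖(ρ.C t *ᵥ f t) i‖ ^ 2 ≤ ∑ j, ‖(ρ.C t *ᵥ f t) j‖ ^ 2 :=
    Finset.single_le_sum (f := fun j => ‖(ρ.C t *ᵥ f t) j‖ ^ 2) (fun _ _ => by positivity)
      (Finset.mem_univ i)
  rw [Real.norm_of_nonneg (by positivity)]
  refine le_trans ?_ (Complex.re_le_norm _)
  rw [h1, Complex.add_re, h5, h4]
  exact h6.trans (le_add_of_nonneg_left h3)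

/-- Although neither `S` nor `P f` need be locally bounded, their product is locally integrable,
because `f` has integrable weighted products with all elements of `L²(I; W)`. -/
theorem integrableOn_S {a b : ℝ} (hab : Set.Icc a b ⊆ I) (f : W.L2) :
    IntegrableOn (fun t => ρ.S t *ᵥ (ρ.P *ᵥ f t)) (Set.Icc a b) := by
  refine Integrable.of_eval fun i => ?_
  -- pair `f` with the element whose first coordinate is the `i`-th unit vector on `[a, b]`
  obtain ⟨κ, hκ⟩ := ρ.exists_of_coordinates hab (w := fun _ => Pi.single i 1) continuous_const
    (θ := 0) (by exact MemLp.zero)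
  have h1 : Integrable (fun t => star (W.innerAt t (f t) (κ t))) (volume.restrict I) :=
    memLp_one_iff_integrable.mp (memLp_one_iff_integrable.mpr (f.integrable_innerAt κ)).star
  have h2 := h1.mono_measure (Measure.restrict_mono hab le_rfl)
  refine h2.congr ?_
  filter_upwards [ae_restrict_of_ae_restrict_of_subset hab hκ,
    ae_restrict_of_ae_restrict_of_subset hab ρ.innerAt_eq,
    ae_restrict_mem measurableSet_Icc] with t h3 h4 h5
  rw [h4, h3.1, h3.2]
  simp [h5]

end Reduction

end Reduced

/-! ### Existence of the reduced form -/

section SchurComplement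

/-- The blocks of `Vᴴ X V` in terms of the two groups of rows of `Vᴴ`. -/
theorem toBlocks_conjTranspose_mul_mul {k l n : Type*} [Fintype n] {V : Matrix n (k ⊕ l) ℂ}
    (X : Matrix n n ℂ) :
    (Vᴴ * X * V).toBlocks₁₁ =
        Vᴴ.submatrix Sum.inl id * X * (Vᴴ.submatrix Sum.inl id)ᴴ ∧
      (Vᴴ * X * V).toBlocks₁₂ =
        Vᴴ.submatrix Sum.inl id * X * (Vᴴ.submatrix Sum.inr id)ᴴ ∧
      (Vᴴ * X * V).toBlocks₂₁ =
        Vᴴ.submatrix Sum.inr id * X * (Vᴴ.submatrix Sum.inl id)ᴴ ∧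
      (Vᴴ * X * V).toBlocks₂₂ =
        Vᴴ.submatrix Sum.inr id * X * (Vᴴ.submatrix Sum.inr id)ᴴ := by
  simp only [conjTranspose_submatrix, conjTranspose_conjTranspose]
  exact ⟨rfl, rfl, rfl, rfl⟩

variable {k l n : Type*} [Fintype k] [Fintype l] [Fintype n] [DecidableEq l]
  [DecidableEq n] {P : Matrix k n ℂ} {Q : Matrix l n ℂ}

/-- Block elimination: if the rows of `P` and `Q` together form an orthonormal basis, then `X`
minus its Schur part `X Qᴴ (Q X Qᴴ)⁻¹ Q X` lives on the block of `P` alone. -/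
theorem schur_decomposition (h1 : Pᴴ * P + Qᴴ * Q = 1) {X : Matrix n n ℂ}
    {Y : Matrix l l ℂ} (hY : Q * X * Qᴴ * Y = 1) :
    X = Pᴴ * (P * X * Pᴴ - P * X * Qᴴ * Y * (Q * X * Pᴴ)) * P + X * Qᴴ * Y * (Q * X) := by
  have hY' := mul_eq_one_comm.mp hY
  set Z := X - X * Qᴴ * Y * (Q * X) with hZ
  have hQZ : Q * Z = 0 := by
    rw [hZ, Matrix.mul_sub, sub_eq_zero]
    calc Q * X = (Q * X * Qᴴ * Y) * (Q * X) := by rw [hY, Matrix.one_mul]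
      _ = _ := by simp only [Matrix.mul_assoc]
  have hZQ : Z * Qᴴ = 0 := by
    rw [hZ, Matrix.sub_mul, sub_eq_zero]
    calc X * Qᴴ = X * Qᴴ * (Y * (Q * X * Qᴴ)) := by rw [hY', Matrix.mul_one]
      _ = _ := by simp only [Matrix.mul_assoc]
  have h2 : Pᴴ * (P * Z) = Z := by
    calc Pᴴ * (P * Z) = (Pᴴ * P + Qᴴ * Q) * Z := by
          rw [Matrix.add_mul, Matrix.mul_assoc, Matrix.mul_assoc, hQZ, Matrix.mul_zero, add_zero]
      _ = Z := by rw [h1, Matrix.one_mul]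
  have h3 : Z * Pᴴ * P = Z := by
    calc Z * Pᴴ * P = Z * (Pᴴ * P + Qᴴ * Q) := by
          rw [Matrix.mul_add, ← Matrix.mul_assoc, ← Matrix.mul_assoc, hZQ, Matrix.zero_mul,
            add_zero]
      _ = Z := by rw [h1, Matrix.mul_one]
  have h4 : P * X * Pᴴ - P * X * Qᴴ * Y * (Q * X * Pᴴ) = P * Z * Pᴴ := by
    rw [hZ]
    simp only [Matrix.mul_sub, Matrix.sub_mul, Matrix.mul_assoc]
  have h5 : Pᴴ * (P * Z * Pᴴ) * P = Z := by
    calc Pᴴ * (P * Z * Pᴴ) * P = Pᴴ * (P * Z) * Pᴴ * P := by simp only [Matrix.mul_assoc]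
      _ = Z := by rw [h2, h3]
  rw [h4, h5, hZ, sub_add_cancel]

end SchurComplement

section Existence

variable {n : ℕ} {I : Set ℝ}

theorem MatMemLpLoc.sub {p : ENNReal} {k m : ℕ} {A B : ℝ → Matrix (Fin k) (Fin m) ℂ}
    (hA : MatMemLpLoc p I A) (hB : MatMemLpLoc p I B) :
    MatMemLpLoc p I fun t => A t - B t := fun i j =>
  ⟨(hA i j).1.sub (hB i j).1, fun a b hab => ((hA i j).2 a b hab).sub ((hB i j).2 a b hab)⟩

theorem MatMemLpLoc.zero {p : ENNReal} {k m : ℕ} :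
    MatMemLpLoc p I fun _ => (0 : Matrix (Fin k) (Fin m) ℂ) := fun _ _ =>
  ⟨aestronglyMeasurable_const, fun _ _ _ => MemLp.zero⟩

/-- A measurable matrix function is locally square integrable if its Gram matrix is locally
integrable. -/
theorem MatMemLpLoc.of_gram {k m : ℕ} {A : ℝ → Matrix (Fin k) (Fin m) ℂ}
    {B : ℝ → Matrix (Fin m) (Fin m) ℂ}
    (hA : AEStronglyMeasurable A (volume.restrict I)) (hB : MatMemLpLoc 1 I B)
    (h : ∀ᵐ t ∂volume.restrict I, (A t)ᴴ * A t = B t) : MatMemLpLoc 2 I A := by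
  intro i j
  have hm := aestronglyMeasurable_entry hA i j
  refine ⟨hm, fun a b hab => ?_⟩
  have hm' := hm.mono_measure (Measure.restrict_mono hab le_rfl)
  refine (memLp_two_iff_integrable_sq_norm hm').mpr ?_
  refine (memLp_one_iff_integrable.mp ((hB j j).2 a b hab)).norm.mono' (hm'.norm.pow 2) ?_
  filter_upwards [ae_restrict_of_ae_restrict_of_subset hab h] with t ht
  rw [Real.norm_of_nonneg (by positivity)]
  refine le_trans ?_ (Complex.re_le_norm _)
  have h5 : (B t j j).re = ∑ x, ‖A t x j‖ ^ 2 := by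
    rw [← ht, mul_apply, Complex.re_sum]
    refine Finset.sum_congr rfl fun x _ => ?_
    rw [conjTranspose_apply, Complex.star_def, Complex.conj_mul', ← Complex.ofReal_pow,
      Complex.ofReal_re]
  rw [h5]
  exact Finset.single_le_sum (f := fun x => ‖A t x j‖ ^ 2) (fun _ _ => by positivity)
    (Finset.mem_univ i)

/-- For invertible `J` there are no algebraic equations, and the system is already reduced. -/
theorem exists_reduction_of_det_ne_zero {J : Matrix (Fin n) (Fin n) ℂ} (hJ : J.det ≠ 0)
    (hJ_skew : Jᴴ = -J) {H : ℝ → Matrix (Fin n) (Fin n) ℂ} {W : Weight n I}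
    (hH : MatMemLpLoc 1 I H) (hW : MatMemLpLoc 1 I W.toFun) :
    Nonempty (Reduction W J H n 0) := ⟨{
  J₁ := J
  P := 1
  C := fun _ => 0
  E := fun _ => 1
  D := fun _ => 0
  S := W.toFun
  A := H
  F := fun _ => 0
  G := fun _ => 0
  M := fun _ => 0
  N := fun _ => 0
  isUnit_J₁ := hJ.isUnit
  J₁_skew := hJ_skew
  J_eq := by simp
  P_mul := by simp
  P_E := by simp
  P_D := by simp
  C_E := by simp
  C_D := Filter.Eventually.of_forall fun _ => Subsingleton.elim _ _
  E_P := by simp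
  W_eq := by simp
  H_eq := by simp
  N_M := Filter.Eventually.of_forall fun _ => Subsingleton.elim _ _
  C_meas := fun _ _ => aestronglyMeasurable_const
  E_meas := fun _ _ => aestronglyMeasurable_const
  D_meas := fun _ _ => aestronglyMeasurable_const
  S_loc := hW
  A_loc := hH
  F_loc := MatMemLpLoc.zero
  G_loc := MatMemLpLoc.zero
  M_loc := MatMemLpLoc.zero }⟩

/-- For singular `J`, the reduced form is obtained by eliminating the components in the kernel
of `J`; its coefficients `A`, `S` are the Schur complements of `H₂₂`, `W₂₂`, and the second
coordinate is `W₂₂^(-1/2) (W f)₂`. -/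
theorem exists_reduction_of_blockIndexOne {J : Matrix (Fin n) (Fin n) ℂ} (hJ_skew : Jᴴ = -J)
    {H : ℝ → Matrix (Fin n) (Fin n) ℂ} {W : Weight n I} {n₁ n₂ : ℕ}
    {V : Matrix (Fin n) (Fin n₁ ⊕ Fin n₂) ℂ} (hV : IsBlockBasis J V)
    (hB : BlockIndexOne I H W.toFun V) : Nonempty (Reduction W J H n₁ n₂) := by
  obtain ⟨hV1, hV2, J₁, hJ₁, hJV⟩ := hV
  obtain ⟨hdet, hH12, hschH, hW11, hH22, hH21, hschW⟩ := hB
  simp only [(toBlocks_conjTranspose_mul_mul _).1, (toBlocks_conjTranspose_mul_mul _).2.1,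
    (toBlocks_conjTranspose_mul_mul _).2.2.1, (toBlocks_conjTranspose_mul_mul _).2.2.2]
    at hdet hH12 hschH hW11 hH22 hH21 hschW
  have hVV := fun i j => congrFun (congrFun hV1 i) j
  set P : Matrix (Fin n₁) (Fin n) ℂ := Vᴴ.submatrix Sum.inl id with hP
  set Q : Matrix (Fin n₂) (Fin n) ℂ := Vᴴ.submatrix Sum.inr id with hQ
  have hPH : Pᴴ = V.submatrix id Sum.inl := by
    rw [hP, conjTranspose_submatrix, conjTranspose_conjTranspose]
  have hQH : Qᴴ = V.submatrix id Sum.inr := by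
    rw [hQ, conjTranspose_submatrix, conjTranspose_conjTranspose]
  have hPP : P * Pᴴ = 1 := by
    ext i j
    rw [hPH]
    refine (hVV (Sum.inl i) (Sum.inl j)).trans ?_
    simp [one_apply]
  have hQQ : Q * Qᴴ = 1 := by
    ext i j
    rw [hQH]
    refine (hVV (Sum.inr i) (Sum.inr j)).trans ?_
    simp [one_apply]
  have hPQ : P * Qᴴ = 0 := by
    ext i j
    rw [hQH]
    refine (hVV (Sum.inl i) (Sum.inr j)).trans ?_
    simp
  have h1 : Pᴴ * P + Qᴴ * Q = 1 := by
    rw [hPH, hQH, ← hV2]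
    ext i j
    simp [mul_apply, hP, hQ, Fintype.sum_sum_type]
  have hJeq : J = Pᴴ * J₁ * P := by
    calc J = (V * Vᴴ) * J * (V * Vᴴ) := by rw [hV2]; simp
      _ = V * (Vᴴ * J * V) * Vᴴ := by simp only [Matrix.mul_assoc]
      _ = _ := by
        rw [hJV, hPH]
        ext i j
        simp [mul_apply, hP, Fintype.sum_sum_type]
  have hJ₁eq : P * J * Pᴴ = J₁ := by
    rw [hJeq]
    calc _ = (P * Pᴴ) * J₁ * (P * Pᴴ) := by simp only [Matrix.mul_assoc]
      _ = _ := by rw [hPP]; simp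
  have hJ₁skew : J₁ᴴ = -J₁ := by
    rw [← hJ₁eq, conjTranspose_mul, conjTranspose_mul, conjTranspose_conjTranspose, hJ_skew]
    simp [Matrix.mul_assoc]
  -- the block `W₂₂` and its square root
  set R : ℝ → Matrix (Fin n₂) (Fin n₂) ℂ := fun t => psdSqrt (Q * W.toFun t * Qᴴ) with hR
  have hW22 : ∀ᵐ t ∂volume.restrict I, (Q * W.toFun t * Qᴴ).PosSemidef := by
    filter_upwards [W.posSemidef] with t ht using ht.mul_mul_conjTranspose_same Q
  have hRR : ∀ᵐ t ∂volume.restrict I, R t * R t = Q * W.toFun t * Qᴴ := by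
    filter_upwards [hW22] with t ht using psdSqrt_mul_self ht
  have hRH : ∀ t, ((R t)⁻¹)ᴴ = (R t)⁻¹ := fun t => by
    rw [conjTranspose_nonsing_inv, hR, psdSqrt_isHermitian]
  have hRu : ∀ᵐ t ∂volume.restrict I, IsUnit (R t).det := by
    filter_upwards [hRR, W.posSemidef, W.det_ne_zero] with t h2 h3 h4
    have h5 : (W.toFun t).PosDef :=
      h3.posDef_iff_isUnit.mpr ((isUnit_iff_isUnit_det _).mpr h4.isUnit)
    have h6 : (Q * W.toFun t * Qᴴ).PosDef := by
      refine h5.mul_mul_conjTranspose_same ?_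
      intro x y hxy
      have := congrArg (fun z => z ᵥ* Qᴴ) hxy
      simpa [vecMul_vecMul, hQQ] using this
    have h7 := (isUnit_iff_isUnit_det _).mp h6.isUnit
    rw [← h2, det_mul] at h7
    exact isUnit_of_mul_isUnit_left h7
  have hWm : AEStronglyMeasurable W.toFun (volume.restrict I) :=
    aestronglyMeasurable_matrix W.measurable
  have hRim : AEStronglyMeasurable (fun t => (R t)⁻¹) (volume.restrict I) := by
    refine aestronglyMeasurable_matrix_inv (aestronglyMeasurable_matrix ?_)
    refine aestronglyMeasurable_psdSqrt (aestronglyMeasurable_entry ?_) hW22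
    exact aestronglyMeasurable_matrix_mul (aestronglyMeasurable_matrix_mul
      aestronglyMeasurable_const hWm) aestronglyMeasurable_const
  -- `W₂₂^(-1/2) W₂₁` has Gram matrix `W₁₁` minus the Schur complement of `W₂₂`
  have hGram : MatMemLpLoc 2 I fun t => (R t)⁻¹ * (Q * W.toFun t * Pᴴ) := by
    refine MatMemLpLoc.of_gram (aestronglyMeasurable_matrix_mul hRim
      (aestronglyMeasurable_matrix_mul (aestronglyMeasurable_matrix_mul
      aestronglyMeasurable_const hWm) aestronglyMeasurable_const)) (hW11.sub hschW) ?_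
    filter_upwards [hRR, W.posSemidef] with t h2 h3
    rw [sub_sub_cancel, ← h2, Matrix.mul_inv_rev, conjTranspose_mul, hRH, conjTranspose_mul,
      conjTranspose_mul, conjTranspose_conjTranspose, h3.isHermitian.eq]
    simp only [Matrix.mul_assoc]
  have hWQ : ∀ᵐ t ∂volume.restrict I, ((R t)⁻¹ * (Q * W.toFun t))ᴴ =
      W.toFun t * Qᴴ * (R t)⁻¹ := by
    filter_upwards [W.posSemidef] with t h3
    rw [conjTranspose_mul, hRH, conjTranspose_mul, h3.isHermitian.eq]
  have hH22inv : ∀ᵐ t ∂volume.restrict I,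
      (Q * H t * Qᴴ) * (Q * H t * Qᴴ)⁻¹ = 1 := by
    filter_upwards [hdet] with t ht using mul_nonsing_inv _ ht.isUnit
  refine ⟨{
    J₁ := J₁
    P := P
    C := fun t => (R t)⁻¹ * (Q * W.toFun t)
    E := fun t => Pᴴ - Qᴴ * ((R t)⁻¹ * (R t)⁻¹) * (Q * W.toFun t * Pᴴ)
    D := fun t => Qᴴ * (R t)⁻¹
    S := _
    A := _
    F := fun t => ((R t)⁻¹ * (Q * W.toFun t * Pᴴ))ᴴ -
      P * H t * Qᴴ * (Q * H t * Qᴴ)⁻¹ * R t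
    G := fun t => R t * ((Q * W.toFun t * Qᴴ)⁻¹ * (Q * W.toFun t * Pᴴ) -
      (Q * H t * Qᴴ)⁻¹ * (Q * H t * Pᴴ))
    M := fun t => R t * (Q * H t * Qᴴ)⁻¹ * R t
    N := fun t => (R t)⁻¹ * (Q * H t * Qᴴ) * (R t)⁻¹
    isUnit_J₁ := hJ₁.isUnit
    J₁_skew := hJ₁skew
    J_eq := hJeq
    P_mul := hPP
    P_E := Filter.Eventually.of_forall fun t => ?_
    P_D := Filter.Eventually.of_forall fun t => ?_
    C_E := ?_
    C_D := ?_
    E_P := ?_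
    W_eq := ?_
    H_eq := ?_
    N_M := ?_
    C_meas := ?_
    E_meas := ?_
    D_meas := ?_
    S_loc := hschW
    A_loc := hschH
    F_loc := hGram.conjTranspose.sub hH12
    G_loc := hH21
    M_loc := hH22 }⟩
  · rw [Matrix.mul_sub, hPP, Matrix.mul_assoc Qᴴ, ← Matrix.mul_assoc P, hPQ, Matrix.zero_mul,
      sub_zero]
  · rw [← Matrix.mul_assoc, hPQ, Matrix.zero_mul]
  · filter_upwards [hRR, hRu] with t h2 h3
    rw [Matrix.mul_sub, sub_eq_zero]
    calc (R t)⁻¹ * (Q * W.toFun t) * Pᴴ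
        = (((R t)⁻¹ * R t) * (R t * (R t)⁻¹)) * ((R t)⁻¹ * (Q * W.toFun t) * Pᴴ) := by
          rw [nonsing_inv_mul _ h3, mul_nonsing_inv _ h3]; simp
      _ = (R t)⁻¹ * (R t * R t) * (R t)⁻¹ * ((R t)⁻¹ * (Q * W.toFun t) * Pᴴ) := by
          simp only [Matrix.mul_assoc]
      _ = _ := by rw [h2]; simp only [Matrix.mul_assoc]
  · filter_upwards [hRR, hRu] with t h2 h3
    calc (R t)⁻¹ * (Q * W.toFun t) * (Qᴴ * (R t)⁻¹)
        = (R t)⁻¹ * (Q * W.toFun t * Qᴴ) * (R t)⁻¹ := by simp only [Matrix.mul_assoc]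
      _ = ((R t)⁻¹ * R t) * (R t * (R t)⁻¹) := by rw [← h2]; simp only [Matrix.mul_assoc]
      _ = 1 := by rw [nonsing_inv_mul _ h3, mul_nonsing_inv _ h3, Matrix.one_mul]
  · filter_upwards [hRR, hRu] with t h2 h3
    calc (Pᴴ - Qᴴ * ((R t)⁻¹ * (R t)⁻¹) * (Q * W.toFun t * Pᴴ)) * P +
          Qᴴ * (R t)⁻¹ * ((R t)⁻¹ * (Q * W.toFun t))
        = Pᴴ * P + Qᴴ * ((R t)⁻¹ * (R t)⁻¹) * (Q * W.toFun t) * (1 - Pᴴ * P) := by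
          simp only [Matrix.sub_mul, Matrix.mul_sub, Matrix.mul_one, Matrix.mul_assoc]
          abel
      _ = Pᴴ * P + Qᴴ * ((R t)⁻¹ * (R t)⁻¹) * (Q * W.toFun t * Qᴴ) * Q := by
          rw [← h1, add_sub_cancel_left]
          simp only [Matrix.mul_assoc]
      _ = Pᴴ * P + Qᴴ * ((R t)⁻¹ * ((R t)⁻¹ * R t) * R t) * Q := by
          rw [← h2]
          simp only [Matrix.mul_assoc]
      _ = 1 := by rw [nonsing_inv_mul _ h3, Matrix.mul_one, nonsing_inv_mul _ h3, Matrix.mul_one,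
          h1]
  · filter_upwards [hRR, hRu, hWQ] with t h2 h3 h4
    have h5 : (Q * W.toFun t * Qᴴ) * (Q * W.toFun t * Qᴴ)⁻¹ = 1 := by
      refine mul_nonsing_inv _ ?_
      rw [← h2, det_mul]
      exact h3.mul h3
    have h6 := schur_decomposition h1 h5
    rw [h4]
    refine h6.trans ?_
    congr 1
    rw [← h2, Matrix.mul_inv_rev]
    simp only [Matrix.mul_assoc]
  · filter_upwards [hRR, hRu, hWQ, hH22inv, W.posSemidef] with t h2 h3 h4 h5 h6
    have h5' := mul_eq_one_comm.mp h5
    set Y := (Q * H t * Qᴴ)⁻¹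
    have hPPQ : Pᴴ * P = 1 - Qᴴ * Q := eq_sub_of_add_eq h1
    have hWi : (Q * W.toFun t * Qᴴ)⁻¹ = (R t)⁻¹ * (R t)⁻¹ := by rw [← h2, Matrix.mul_inv_rev]
    have hRi := mul_nonsing_inv _ h3
    have hRi' := nonsing_inv_mul _ h3
    -- `C - G P = W₂₂^(1/2) H₂₂⁻¹ (H f)₂` as maps of `f`: the terms with `W` cancel
    have hCG : (R t)⁻¹ * (Q * W.toFun t) - R t * ((Q * W.toFun t * Qᴴ)⁻¹ * (Q * W.toFun t * Pᴴ) -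
        Y * (Q * H t * Pᴴ)) * P = R t * (Y * (Q * H t)) := by
      calc _ = (R t)⁻¹ * (Q * W.toFun t) - (R t * (R t)⁻¹) * (R t)⁻¹ * (Q * W.toFun t) * (Pᴴ * P) +
            R t * (Y * (Q * H t)) * (Pᴴ * P) := by
            rw [hWi]
            simp only [Matrix.sub_mul, Matrix.mul_sub, Matrix.mul_assoc]
            abel
        _ = (R t)⁻¹ * (Q * W.toFun t * Qᴴ) * Q + R t * (Y * (Q * H t)) -
            R t * (Y * (Q * H t * Qᴴ)) * Q := by
            rw [hPPQ, hRi]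
            simp only [Matrix.mul_sub, Matrix.mul_one, Matrix.one_mul, Matrix.mul_assoc]
            abel
        _ = ((R t)⁻¹ * R t) * R t * Q + R t * (Y * (Q * H t)) - R t * Q := by
            rw [h5', ← h2]
            simp only [Matrix.mul_one, Matrix.mul_assoc]
        _ = _ := by rw [hRi']; simp
    -- likewise `Cᴴ - Pᴴ F = H Qᴴ H₂₂⁻¹ W₂₂^(1/2)`
    have hCF : ((R t)⁻¹ * (Q * W.toFun t))ᴴ - Pᴴ * (((R t)⁻¹ * (Q * W.toFun t * Pᴴ))ᴴ -
        P * H t * Qᴴ * Y * R t) = H t * Qᴴ * Y * R t := by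
      have h7 : ((R t)⁻¹ * (Q * W.toFun t * Pᴴ))ᴴ = P * W.toFun t * Qᴴ * (R t)⁻¹ := by
        rw [conjTranspose_mul, hRH, conjTranspose_mul, conjTranspose_mul,
          conjTranspose_conjTranspose, h6.isHermitian.eq]
        simp only [Matrix.mul_assoc]
      rw [h4, h7]
      calc _ = W.toFun t * Qᴴ * (R t)⁻¹ - (Pᴴ * P) * (W.toFun t * Qᴴ * (R t)⁻¹) +
            (Pᴴ * P) * (H t * Qᴴ * Y * R t) := by
            simp only [Matrix.mul_sub, Matrix.mul_assoc]
            abel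
        _ = Qᴴ * ((Q * W.toFun t * Qᴴ) * (R t)⁻¹) + H t * Qᴴ * Y * R t -
            Qᴴ * ((Q * H t * Qᴴ) * Y * R t) := by
            rw [hPPQ]
            simp only [Matrix.sub_mul, Matrix.one_mul, Matrix.mul_assoc]
            abel
        _ = Qᴴ * (R t * (R t * (R t)⁻¹)) + H t * Qᴴ * Y * R t - Qᴴ * R t := by
            rw [h5, ← h2, Matrix.one_mul]
            simp only [Matrix.mul_assoc]
        _ = _ := by rw [hRi]; simp
    rw [hCG, hCF]
    have h8 : H t * Qᴴ * Y * R t * ((R t)⁻¹ * (Q * H t * Qᴴ) * (R t)⁻¹) * (R t * (Y * (Q * H t))) =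
        H t * Qᴴ * Y * (Q * H t) := by
      calc _ = H t * Qᴴ * Y * (R t * (R t)⁻¹) * (Q * H t * Qᴴ) * ((R t)⁻¹ * R t) *
            (Y * (Q * H t)) := by simp only [Matrix.mul_assoc]
        _ = H t * Qᴴ * Y * ((Q * H t * Qᴴ) * Y) * (Q * H t) := by
            rw [hRi, hRi', Matrix.mul_one, Matrix.mul_one]
            simp only [Matrix.mul_assoc]
        _ = _ := by rw [h5, Matrix.mul_one]
    rw [h8]
    exact schur_decomposition h1 h5
  · filter_upwards [hRu, hH22inv] with t h3 h5
    calc _ = (R t)⁻¹ * (Q * H t * Qᴴ) * ((R t)⁻¹ * R t) * (Q * H t * Qᴴ)⁻¹ * R t := by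
          simp only [Matrix.mul_assoc]
      _ = (R t)⁻¹ * ((Q * H t * Qᴴ) * (Q * H t * Qᴴ)⁻¹) * R t := by
          rw [nonsing_inv_mul _ h3, Matrix.mul_one]
          simp only [Matrix.mul_assoc]
      _ = 1 := by rw [h5, Matrix.mul_one, nonsing_inv_mul _ h3]
  · exact aestronglyMeasurable_entry (aestronglyMeasurable_matrix_mul hRim
      (aestronglyMeasurable_matrix_mul aestronglyMeasurable_const hWm))
  · refine aestronglyMeasurable_entry (aestronglyMeasurable_const.sub
      (aestronglyMeasurable_matrix_mul (aestronglyMeasurable_matrix_mul aestronglyMeasurable_const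
      (aestronglyMeasurable_matrix_mul hRim hRim)) (aestronglyMeasurable_matrix_mul
      (aestronglyMeasurable_matrix_mul aestronglyMeasurable_const hWm)
      aestronglyMeasurable_const)))
  · exact aestronglyMeasurable_entry (aestronglyMeasurable_matrix_mul aestronglyMeasurable_const
      hRim)

theorem exists_reduction {J : Matrix (Fin n) (Fin n) ℂ} (hJ_skew : Jᴴ = -J)
    {H : ℝ → Matrix (Fin n) (Fin n) ℂ} {W : Weight n I} (hidx : LocalIndexOne I J H W.toFun) :
    ∃ n₁ n₂ : ℕ, Nonempty (Reduction W J H n₁ n₂) := by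
  by_cases hJ : J.det = 0
  · obtain ⟨n₁, n₂, V, hV, hB⟩ := hidx.2 hJ
    exact ⟨n₁, n₂, exists_reduction_of_blockIndexOne hJ_skew hV hB⟩
  · exact ⟨n, 0, exists_reduction_of_det_ne_zero hJ hJ_skew (hidx.1 hJ).1 (hidx.1 hJ).2⟩

end Existence

/-! ### Solutions of the reduced differential equation -/

section Solutions

open Set

variable {m : ℕ}

theorem AbsolutelyContinuousOnInterval.finset_sum {ι F : Type*} [SeminormedAddCommGroup F]
    {f : ι → ℝ → F} {a b : ℝ} (s : Finset ι)
    (h : ∀ i ∈ s, AbsolutelyContinuousOnInterval (f i) a b) :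
    AbsolutelyContinuousOnInterval (fun t => ∑ i ∈ s, f i t) a b := by
  classical
  induction s using Finset.induction_on with
  | empty =>
    simp only [Finset.sum_empty]
    exact (LipschitzOnWith.of_dist_le_mul (K := 0) (by simp)).absolutelyContinuousOnInterval
  | insert i s hi ih =>
    simp only [Finset.sum_insert hi]
    exact (h i (Finset.mem_insert_self i s)).fun_add
      (ih fun j hj => h j (Finset.mem_insert_of_mem hj))

theorem AbsolutelyContinuousOnInterval.complex_star {f : ℝ → ℂ} {a b : ℝ}
    (hf : AbsolutelyContinuousOnInterval f a b) :
    AbsolutelyContinuousOnInterval (fun t => star (f t)) a b :=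
  .of_dist_le 1 hf fun x _ y _ => by
    rw [one_mul, dist_eq_norm, dist_eq_norm, ← star_sub, norm_star]

theorem AbsolutelyContinuousOnInterval.eval {f : ℝ → Fin m → ℂ} {a b : ℝ}
    (hf : AbsolutelyContinuousOnInterval f a b) (i : Fin m) :
    AbsolutelyContinuousOnInterval (fun t => f t i) a b :=
  .of_dist_le 1 hf fun x _ y _ => by
    rw [one_mul]
    exact dist_le_pi_dist (f x) (f y) i

theorem HasDerivAt.mulVec_const {k : ℕ} (K : Matrix (Fin k) (Fin m) ℂ) {y : ℝ → Fin m → ℂ}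
    {y' : Fin m → ℂ} {t : ℝ} (hy : HasDerivAt y y' t) :
    HasDerivAt (fun s => K *ᵥ y s) (K *ᵥ y') t := by
  refine hasDerivAt_pi.mpr fun i => ?_
  change HasDerivAt (fun s => ∑ j, K i j * y s j) (∑ j, K i j * y' j) t
  exact HasDerivAt.fun_sum fun j _ => (hasDerivAt_pi.mp hy j).const_mul (K i j)

theorem HasDerivAt.star_dotProduct_mulVec (K : Matrix (Fin m) (Fin m) ℂ)
    {y w : ℝ → Fin m → ℂ} {y' w' : Fin m → ℂ} {t : ℝ} (hy : HasDerivAt y y' t)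
    (hw : HasDerivAt w w' t) :
    HasDerivAt (fun s => star (y s) ⬝ᵥ (K *ᵥ w s))
      (star y' ⬝ᵥ (K *ᵥ w t) + star (y t) ⬝ᵥ (K *ᵥ w')) t := by
  rw [dotProduct, dotProduct, ← Finset.sum_add_distrib]
  exact HasDerivAt.fun_sum fun i _ =>
    (hasDerivAt_pi.mp hy i).star.fun_mul (hasDerivAt_pi.mp (hw.mulVec_const K) i)

theorem AbsolutelyContinuousOnInterval.mulVec_const {k : ℕ} (K : Matrix (Fin k) (Fin m) ℂ)
    {y : ℝ → Fin m → ℂ} {a b : ℝ}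
    (hy : ∀ i, AbsolutelyContinuousOnInterval (fun t => y t i) a b) (i : Fin k) :
    AbsolutelyContinuousOnInterval (fun t => (K *ᵥ y t) i) a b := by
  change AbsolutelyContinuousOnInterval (fun t => ∑ j, K i j • y t j) a b
  exact .finset_sum _ fun j _ => (hy j).const_smul (K i j)

/-- Lagrange's identity: integration of the derivative of the form `y^* K w`. -/
theorem integral_deriv_star_dotProduct (K : Matrix (Fin m) (Fin m) ℂ)
    {y w y' w' : ℝ → Fin m → ℂ} {a b : ℝ} (hab : a ≤ b)
    (hy : ∀ i, AbsolutelyContinuousOnInterval (fun t => y t i) a b)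
    (hw : ∀ i, AbsolutelyContinuousOnInterval (fun t => w t i) a b)
    (hy' : ∀ᵐ t ∂volume.restrict (Icc a b), HasDerivAt y (y' t) t)
    (hw' : ∀ᵐ t ∂volume.restrict (Icc a b), HasDerivAt w (w' t) t)
    (hint : IntegrableOn
      (fun t => star (y' t) ⬝ᵥ (K *ᵥ w t) + star (y t) ⬝ᵥ (K *ᵥ w' t)) (Icc a b)) :
    ∫ t in Icc a b, (star (y' t) ⬝ᵥ (K *ᵥ w t) + star (y t) ⬝ᵥ (K *ᵥ w' t)) =
      star (y b) ⬝ᵥ (K *ᵥ w b) - star (y a) ⬝ᵥ (K *ᵥ w a) := by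
  rw [integral_Icc_eq_integral_Ioc, ← intervalIntegral.integral_of_le hab]
  refine AbsolutelyContinuousOnInterval.integral_eq_sub
    (f := fun t => star (y t) ⬝ᵥ (K *ᵥ w t)) ?_
    ((intervalIntegrable_iff_integrableOn_Icc_of_le hab).mpr hint) ?_
  · exact .finset_sum _ fun i _ => (hy i).complex_star.fun_smul
      (AbsolutelyContinuousOnInterval.mulVec_const K hw i)
  · rw [uIcc_of_le hab]
    filter_upwards [(ae_restrict_iff' measurableSet_Icc).mp hy',
      (ae_restrict_iff' measurableSet_Icc).mp hw'] with t h1 h2 ht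
    exact (h1 ht).star_dotProduct_mulVec K (h2 ht)

/-- `y` is a solution of `J₁ y' + A y = q` on `[a, b]` with derivative `r`. Outside `[a, b]` the
function `y` is only required to be a primitive of the integrable function `r`. -/
structure SolvesOn (J₁ : Matrix (Fin m) (Fin m) ℂ) (A : ℝ → Matrix (Fin m) (Fin m) ℂ)
    (q : ℝ → Fin m → ℂ) (a b : ℝ) (y r : ℝ → Fin m → ℂ) : Prop where
  continuous : Continuous y
  integrable : Integrable r
  eq_add_integral : ∀ s t, y t = y s + ∫ x in s..t, r x
  equation : ∀ t ∈ Icc a b, J₁ *ᵥ r t + A t *ᵥ y t = q t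

namespace SolvesOn

variable {J₁ : Matrix (Fin m) (Fin m) ℂ} {A : ℝ → Matrix (Fin m) (Fin m) ℂ}
  {q p : ℝ → Fin m → ℂ} {a b c d : ℝ} {y r w s : ℝ → Fin m → ℂ}

theorem absolutelyContinuous (h : SolvesOn J₁ A q a b y r) (c d : ℝ) (i : Fin m) :
    AbsolutelyContinuousOnInterval (fun t => y t i) c d := by
  refine AbsolutelyContinuousOnInterval.eval (.of_dist_le 1
    (h.integrable.intervalIntegrable.absolutelyContinuousOnInterval_primitive
    (left_mem_uIcc (a := c) (b := d))) fun x _ z _ => ?_) i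
  rw [h.eq_add_integral c x, h.eq_add_integral c z, dist_add_left, one_mul]

theorem hasDerivAt (h : SolvesOn J₁ A q a b y r) : ∀ᵐ t, HasDerivAt y (r t) t := by
  filter_upwards [LocallyIntegrable.ae_hasDerivAt_integral h.integrable.locallyIntegrable]
    with t ht
  rw [show y = fun u => y a + ∫ x in a..u, r x from funext fun u => h.eq_add_integral a u]
  exact (ht a).const_add _

theorem mono (h : SolvesOn J₁ A q a b y r) (hcd : Icc c d ⊆ Icc a b) :
    SolvesOn J₁ A q c d y r :=
  ⟨h.continuous, h.integrable, h.eq_add_integral, fun t ht => h.equation t (hcd ht)⟩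

theorem add (h : SolvesOn J₁ A q a b y r) (h' : SolvesOn J₁ A p a b w s) :
    SolvesOn J₁ A (fun t => q t + p t) a b (fun t => y t + w t) (fun t => r t + s t) where
  continuous := h.continuous.add h'.continuous
  integrable := h.integrable.add h'.integrable
  eq_add_integral x t := by
    rw [intervalIntegral.integral_add h.integrable.intervalIntegrable
      h'.integrable.intervalIntegrable, h.eq_add_integral x t, h'.eq_add_integral x t]
    abel
  equation t ht := by
    rw [← h.equation t ht, ← h'.equation t ht, mulVec_add, mulVec_add]
    abel

theorem zero : SolvesOn J₁ A (fun _ => 0) a b (fun _ => 0) (fun _ => 0) where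
  continuous := continuous_const
  integrable := integrable_zero _ _ _
  eq_add_integral := by simp
  equation := by simp

theorem const_smul (k : ℂ) (h : SolvesOn J₁ A (fun _ => 0) a b y r) :
    SolvesOn J₁ A (fun _ => 0) a b (fun t => k • y t) (fun t => k • r t) where
  continuous := h.continuous.const_smul k
  integrable := h.integrable.smul k
  eq_add_integral x t := by
    rw [intervalIntegral.integral_smul, h.eq_add_integral x t, smul_add]
  equation t ht := by
    rw [mulVec_smul, mulVec_smul, ← smul_add, h.equation t ht, smul_zero]

theorem sum {ι : Type*} (S : Finset ι) {y r : ι → ℝ → Fin m → ℂ}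
    (h : ∀ i, SolvesOn J₁ A (fun _ => 0) a b (y i) (r i)) :
    SolvesOn J₁ A (fun _ => 0) a b (fun t => ∑ i ∈ S, y i t) (fun t => ∑ i ∈ S, r i t) := by
  classical
  induction S using Finset.induction_on with
  | empty => simpa using zero
  | insert i S hi ih =>
    simp only [Finset.sum_insert hi]
    simpa using (h i).add ih

/-- Lagrange's identity for solutions of adjoint equations. -/
theorem integral_lagrange (hJ : J₁ᴴ = -J₁) (hab : a ≤ b) (hy : SolvesOn J₁ A p a b y r)
    (hw : SolvesOn J₁ (fun t => (A t)ᴴ) q a b w s) :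
    ∫ t in Icc a b, (star (y t) ⬝ᵥ q t - star (p t) ⬝ᵥ w t) =
      star (y b) ⬝ᵥ (J₁ *ᵥ w b) - star (y a) ⬝ᵥ (J₁ *ᵥ w a) := by
  have hKc : ∀ {f : ℝ → Fin m → ℂ}, Continuous f → Continuous fun t => J₁ *ᵥ f t :=
    fun hf => continuous_const.matrix_mulVec hf
  have hs1 : MemLp (fun t => J₁ *ᵥ s t) 1 (volume.restrict (Icc a b)) :=
    memLp_mulVec (p := ⊤) (q := 1) (fun i j => memLp_top_const _)
      (memLp_one_iff_integrable.mpr hw.integrable.restrict)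
  rw [← integral_deriv_star_dotProduct J₁ hab (hy.absolutelyContinuous a b)
    (hw.absolutelyContinuous a b) (ae_restrict_of_ae hy.hasDerivAt)
    (ae_restrict_of_ae hw.hasDerivAt)]
  · refine setIntegral_congr_fun measurableSet_Icc fun t ht => ?_
    have h1 := hy.equation t ht
    have h2 := hw.equation t ht
    have h3 : star (r t) ⬝ᵥ (J₁ *ᵥ w t) = -(star (J₁ *ᵥ r t) ⬝ᵥ w t) := by
      rw [star_mulVec, hJ, vecMul_neg, neg_dotProduct, neg_neg, dotProduct_mulVec]
    have h4 : star (y t) ⬝ᵥ ((A t)ᴴ *ᵥ w t) = star (A t *ᵥ y t) ⬝ᵥ w t := by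
      rw [star_mulVec, dotProduct_mulVec]
    change star (y t) ⬝ᵥ q t - star (p t) ⬝ᵥ w t = _
    rw [← h1, ← h2, h3, star_add, add_dotProduct, dotProduct_add, h4]
    ring
  · refine Integrable.add ?_ ?_
    · exact integrable_star_dotProduct (p := 1) (q := ⊤)
        (memLp_one_iff_integrable.mpr hy.integrable.restrict)
        ((hKc hw.continuous).memLp_top_Icc a b)
    · exact integrable_star_dotProduct (p := ⊤) (q := 1) (hy.continuous.memLp_top_Icc a b) hs1

/-- Existence of solutions with prescribed initial value. -/
theorem exists_solution (hJ₁ : IsUnit J₁.det)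
    (hA : ∀ i j, IntegrableOn (fun t => A t i j) (Icc a b))
    (hq : IntegrableOn q (Icc a b)) (c : Fin m → ℂ) :
    ∃ y r, SolvesOn J₁ A q a b y r ∧ y a = c ∧ ∀ t ∉ Icc a b, r t = 0 := by
  obtain ⟨y, r, h1, h2, h3, h4, h5⟩ := exists_solution_on_Icc (a := a) (b := b)
    (A := fun t => -(J₁⁻¹ * A t)) (q := fun t => J₁⁻¹ *ᵥ q t) (fun i j => by
      change IntegrableOn (fun t => -∑ k, J₁⁻¹ i k * A t k j) _
      exact (integrable_finsetSum _ fun k _ => (hA k j).const_mul _).neg) (by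
      exact memLp_one_iff_integrable.mp (memLp_mulVec (p := ⊤) (q := 1)
        (fun i j => memLp_top_const _) (memLp_one_iff_integrable.mpr hq))) c
  refine ⟨y, r, ⟨h1, h2, fun s t => ?_, fun t ht => ?_⟩, by simpa using h3 a, h5⟩
  · rw [h3 s, h3 t, add_assoc, intervalIntegral.integral_add_adjacent_intervals
      h2.intervalIntegrable h2.intervalIntegrable]
  · rw [h4 t ht, mulVec_add, neg_mulVec, mulVec_neg, mulVec_mulVec, mulVec_mulVec,
      ← Matrix.mul_assoc, mul_nonsing_inv _ hJ₁, Matrix.one_mul, one_mulVec]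
    abel

/-- A fundamental system of the homogeneous adjoint equation; it is invertible everywhere because
`Ψ^* J₁ Φ` is constant when `Ψ` is a fundamental system of the original equation. -/
theorem exists_fundamental_system (hJ₁ : IsUnit J₁.det) (hJ : J₁ᴴ = -J₁)
    (hA : ∀ i j, IntegrableOn (fun t => A t i j) (Icc a b)) :
    ∃ φ s : Fin m → ℝ → Fin m → ℂ,
      (∀ i, SolvesOn J₁ (fun t => (A t)ᴴ) (fun _ => 0) a b (φ i) (s i)) ∧
      ∀ t ∈ Icc a b, IsUnit (Matrix.of fun j i => φ i t j).det := by
  have hA' : ∀ i j, IntegrableOn (fun t => (A t)ᴴ i j) (Icc a b) := fun i j =>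
    memLp_one_iff_integrable.mp (memLp_one_iff_integrable.mpr (hA j i)).star
  choose φ s hφ hφa _ using fun i : Fin m =>
    exists_solution (q := fun _ => 0) hJ₁ hA' integrableOn_zero (Pi.single i 1)
  choose ψ r hψ hψa _ using fun i : Fin m =>
    exists_solution (q := fun _ => 0) hJ₁ hA integrableOn_zero (Pi.single i 1)
  refine ⟨φ, s, hφ, fun t ht => ?_⟩
  have h1 : ∀ i j, star (ψ i t) ⬝ᵥ (J₁ *ᵥ φ j t) = J₁ i j := fun i j => by
    have hsub : Icc a t ⊆ Icc a b := Icc_subset_Icc_right ht.2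
    have h2 := integral_lagrange hJ ht.1 ((hψ i).mono hsub) ((hφ j).mono hsub)
    rw [hφa, hψa] at h2
    simp only [dotProduct_zero, star_zero, zero_dotProduct, sub_zero, integral_zero] at h2
    rw [eq_comm, sub_eq_zero] at h2
    rw [h2]
    simp
  have h3 : (Matrix.of fun j i => ψ i t j)ᴴ * (J₁ * Matrix.of fun j i => φ i t j) = J₁ := by
    ext i j
    rw [← h1 i j]
    rfl
  have h4 := congrArg Matrix.det h3
  rw [det_mul, det_mul] at h4
  rw [← h4] at hJ₁
  exact isUnit_of_mul_isUnit_right (isUnit_of_mul_isUnit_right hJ₁)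

end SolvesOn

end Solutions

/-! ### The maximal operator of the adjoint system is contained in the adjoint -/

section EasyInclusion

open Set

variable {n : ℕ} {I : Set ℝ}

theorem ae_mem_interior (hI : I.OrdConnected) : ∀ᵐ t ∂volume.restrict I, t ∈ interior I := by
  rw [ae_restrict_iff' hI.measurableSet]
  have h : volume (frontier I) = 0 := hI.convex.addHaar_frontier volume
  filter_upwards [measure_eq_zero_iff_ae_notMem.mp h] with t a b
  by_contra hc
  exact a ⟨subset_closure b, hc⟩

theorem setIntegral_eq_of_ae_eq_zero (hI : I.OrdConnected) {a b : ℝ} (hab : Icc a b ⊆ I)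
    {Z : ℝ → ℂ} (hZ : ∀ᵐ t ∂volume.restrict I, t ∉ Icc a b → Z t = 0) :
    ∫ t in I, Z t = ∫ t in Icc a b, Z t := by
  refine setIntegral_eq_of_subset_of_ae_sdiff_eq_zero hI.measurableSet.nullMeasurableSet hab ?_
  filter_upwards [(ae_restrict_iff' hI.measurableSet).mp hZ] with t h2 h3 using h2 h3.1 h3.2

theorem eq_zero_of_ae_eq_zero_of_isOpen {U : Set ℝ} (hU : IsOpen U) (hUI : U ⊆ interior I)
    {u : ℝ → Fin n → ℂ} (hu : ∀ t ∈ interior I, ContinuousAt u t)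
    (h : ∀ᵐ t ∂volume.restrict I, t ∈ U → u t = 0) : ∀ t ∈ U, u t = 0 := by
  have h1 : u =ᵐ[volume.restrict U] 0 := by
    have h2 := ae_restrict_of_ae_restrict_of_subset (hUI.trans interior_subset) h
    filter_upwards [h2, ae_restrict_mem hU.measurableSet] with t h3 h4 using h3 h4
  have h3 := Measure.eqOn_open_of_ae_eq h1 hU
    (fun t ht => (hu t (hUI ht)).continuousWithinAt) continuousOn_const
  exact fun t ht => h3 ht

theorem HasDerivAt.eq_zero_of_eqOn_isOpen {F : Type*} [NormedAddCommGroup F] [NormedSpace ℝ F]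
    {U : Set ℝ} (hU : IsOpen U) {u : ℝ → F} {v : F} {t : ℝ} (ht : t ∈ U)
    (hu : ∀ s ∈ U, u s = 0) (h : HasDerivAt u v t) : v = 0 := by
  have h1 : u =ᶠ[nhds t] fun _ => 0 := by
    filter_upwards [hU.mem_nhds ht] with s hs using hu s hs
  exact h.unique ((hasDerivAt_const t 0).congr_of_eventuallyEq h1)

/-- A compact subset of the interior of an interval lies strictly inside a compact interval. -/
theorem exists_Icc_of_isCompact_subset_interior (hI : I.OrdConnected)
    (hI_int : (interior I).Nonempty) {K : Set ℝ} (hK : IsCompact K) (hKI : K ⊆ interior I) :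
    ∃ a b, a ≤ b ∧ Icc a b ⊆ interior I ∧ K ⊆ Ioo a b := by
  obtain rfl | hne := K.eq_empty_or_nonempty
  · obtain ⟨c, hc⟩ := hI_int
    exact ⟨c, c, le_rfl, by simpa using hc, empty_subset _⟩
  have h1 := hKI (hK.sInf_mem hne)
  have h2 := hKI (hK.sSup_mem hne)
  obtain ⟨ε, hε, h3⟩ := Metric.isOpen_iff.mp isOpen_interior _ h1
  obtain ⟨δ, hδ, h4⟩ := Metric.isOpen_iff.mp isOpen_interior _ h2
  have h5 : ∀ t ∈ K, sInf K ≤ t ∧ t ≤ sSup K := fun t ht =>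
    ⟨csInf_le hK.bddBelow ht, le_csSup hK.bddAbove ht⟩
  have h6 := (h5 _ (hK.sInf_mem hne)).2
  refine ⟨sInf K - ε / 2, sSup K + δ / 2, by linarith, ?_, fun t ht => ?_⟩
  · refine hI.interior.out (h3 ?_) (h4 ?_)
    · rw [Metric.mem_ball, Real.dist_eq, abs_lt]
      constructor <;> linarith
    · rw [Metric.mem_ball, Real.dist_eq, abs_lt]
      constructor <;> linarith
  · have := h5 t ht
    constructor <;> linarith

variable {W : Weight n I} {J : Matrix (Fin n) (Fin n) ℂ} {H : ℝ → Matrix (Fin n) (Fin n) ℂ}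

theorem mem_graph_maxOp_iff (hI : I.OrdConnected) {f k : W.L2} :
    (f, k) ∈ (maxOp W J H).graph ↔ IsDAImage I J H W.toFun f k := by
  rw [maxOp_graph hI]
  exact Iff.rfl

theorem mem_graph_minOp_iff (hI : I.OrdConnected) {f k : W.L2} :
    (f, k) ∈ (minOp W J H).graph ↔
      IsDAImage I J H W.toFun f k ∧ HasCompactSupportIn I J f := by
  have hle : minOp W J H ≤ maxOp W J H := LinearPMap.domRestrict_le
  rw [← mem_graph_maxOp_iff hI]
  constructor
  · intro h
    have h1 : f ∈ minDomain W J H := by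
      rw [← minOp_domain]
      exact LinearPMap.mem_domain_of_mem_graph h
    exact ⟨LinearPMap.le_graph_of_le hle h, h1.2⟩
  · rintro ⟨h1, h2⟩
    have h3 : f ∈ minDomain W J H := ⟨LinearPMap.mem_domain_of_mem_graph h1, h2⟩
    rw [← minOp_domain] at h3
    have h5 := (minOp W J H).mem_graph ⟨f, h3⟩
    have h6 := LinearPMap.le_graph_of_le hle h5
    rwa [LinearPMap.mem_graph_snd_inj _ h6 h1 rfl] at h5

theorem IsDAImage.weight_mulVec {f g : W.L2} {v : ℝ → Fin n → ℂ}
    (h : ∀ᵐ t ∂volume.restrict I, g t = (W.toFun t)⁻¹ *ᵥ (v t + H t *ᵥ f t)) :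
    ∀ᵐ t ∂volume.restrict I, W.toFun t *ᵥ g t = v t + H t *ᵥ f t := by
  filter_upwards [h, W.det_ne_zero] with t h1 h2
  rw [h1, mulVec_mulVec, mul_nonsing_inv _ h2.isUnit, one_mulVec]

/-- For skew-Hermitian `J`, the pseudoinverse `X` of `J` and the orthogonal projection `T` onto
the range of `J`. -/
theorem exists_pseudoinverse {m : ℕ} {J₁ : Matrix (Fin m) (Fin m) ℂ}
    {P : Matrix (Fin m) (Fin n) ℂ} (hJ : J = Pᴴ * J₁ * P) (hP : P * Pᴴ = 1)
    (hJ₁ : IsUnit J₁.det) (hskew : J₁ᴴ = -J₁) :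
    ∃ X T : Matrix (Fin n) (Fin n) ℂ, Tᴴ = T ∧ X * J = T ∧ Jᴴ * X = -T ∧ T * J = J := by
  subst hJ
  refine ⟨Pᴴ * J₁⁻¹ * P, Pᴴ * P, ?_, ?_, ?_, ?_⟩
  · rw [conjTranspose_mul, conjTranspose_conjTranspose]
  · calc _ = Pᴴ * J₁⁻¹ * (P * Pᴴ) * J₁ * P := by simp only [Matrix.mul_assoc]
      _ = Pᴴ * (J₁⁻¹ * J₁) * P := by
        rw [hP, Matrix.mul_one]
        simp only [Matrix.mul_assoc]
      _ = _ := by rw [nonsing_inv_mul _ hJ₁, Matrix.mul_one]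
  · rw [conjTranspose_mul, conjTranspose_mul, conjTranspose_conjTranspose, hskew]
    calc _ = -(Pᴴ * J₁ * (P * Pᴴ) * J₁⁻¹ * P) := by
          simp only [Matrix.mul_assoc, Matrix.neg_mul, Matrix.mul_neg]
      _ = -(Pᴴ * (J₁ * J₁⁻¹) * P) := by
        rw [hP, Matrix.mul_one]
        simp only [Matrix.mul_assoc]
      _ = _ := by rw [mul_nonsing_inv _ hJ₁, Matrix.mul_one]
  · calc _ = Pᴴ * (P * Pᴴ) * J₁ * P := by simp only [Matrix.mul_assoc]
      _ = _ := by rw [hP, Matrix.mul_one]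

/-- Green's formula: the minimal operator for `H` and the maximal operator for `H^*` are formally
adjoint. The boundary form is `(J f)^* X (J g)` with the pseudoinverse `X` of `J`. -/
theorem Reduction.inner_eq_inner {n₁ n₂ : ℕ} (ρ : Reduction W J H n₁ n₂) (hI : I.OrdConnected)
    (hI_int : (interior I).Nonempty) {f k g h : W.L2}
    (hfk : IsDAImage I J H W.toFun f k) (hf : HasCompactSupportIn I J f)
    (hgh : IsDAImage I J (fun t => (H t)ᴴ) W.toFun g h) :
    inner ℂ k g = inner ℂ f h := by
  obtain ⟨u, v, hu, hfu, huv, hk⟩ := hfk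
  obtain ⟨w, z, hw, hgw, hwz, hh⟩ := hgh
  obtain ⟨K, hK, hKI, hKf⟩ := hf
  have hWk := IsDAImage.weight_mulVec hk
  have hWh := IsDAImage.weight_mulVec hh
  obtain ⟨X, T, hTH, hXJ, hJX, hTJ⟩ :=
    exists_pseudoinverse ρ.J_eq ρ.P_mul ρ.isUnit_J₁ ρ.J₁_skew
  have hmem := ae_mem_interior hI
  -- derivatives of functions with values in the range of `J` stay in that range
  have hrange : ∀ {f : W.L2} {u v : ℝ → Fin n → ℂ}, IsACLoc I u →
      (∀ᵐ t ∂volume.restrict I, J *ᵥ f t = u t) →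
      (∀ᵐ t ∂volume.restrict I, HasDerivAt u (v t) t) →
      ∀ᵐ t ∂volume.restrict I, T *ᵥ v t = v t := by
    intro f u v hu hfu huv
    have h1 : ∀ t ∈ interior I, (1 - T) *ᵥ u t = 0 := by
      refine eq_zero_of_ae_eq_zero_of_isOpen isOpen_interior Subset.rfl
        (fun t ht => (continuous_const.matrix_mulVec continuous_id).continuousAt.comp
          (hu.continuousAt ht)) ?_
      filter_upwards [hfu] with t ht _
      rw [← ht, mulVec_mulVec, Matrix.sub_mul, hTJ, Matrix.one_mul, sub_self, zero_mulVec]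
    filter_upwards [huv, hmem] with t h2 h3
    have h4 := (h2.mulVec_const (1 - T)).eq_zero_of_eqOn_isOpen isOpen_interior h3 h1
    rw [sub_mulVec, one_mulVec, sub_eq_zero] at h4
    exact h4.symm
  have hTv := hrange hu hfu huv
  obtain ⟨a, b, hab, habI, hKab⟩ := exists_Icc_of_isCompact_subset_interior hI hI_int hK hKI
  have habI' : Icc a b ⊆ I := habI.trans interior_subset
  have hUo : IsOpen (interior I \ K) := isOpen_interior.sdiff hK.isClosed
  have hu0 : ∀ t ∈ interior I \ K, u t = 0 := by
    refine eq_zero_of_ae_eq_zero_of_isOpen hUo sdiff_subset (fun t ht => hu.continuousAt ht) ?_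
    filter_upwards [hKf, hfu] with t h1 h2 h3
    rw [← h2, h1 h3.2]
  have hua : u a = 0 := hu0 a ⟨habI (left_mem_Icc.mpr hab), fun h => lt_irrefl a (hKab h).1⟩
  have hub : u b = 0 := hu0 b ⟨habI (right_mem_Icc.mpr hab), fun h => lt_irrefl b (hKab h).2⟩
  set Z : ℝ → ℂ := fun t => star (v t) ⬝ᵥ (X *ᵥ w t) + star (u t) ⬝ᵥ (X *ᵥ z t) with hZ
  have hpt : ∀ᵐ t ∂volume.restrict I,
      W.innerAt t (k t) (g t) - W.innerAt t (f t) (h t) = Z t := by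
    filter_upwards [hWk, hWh, hfu, hgw, hTv, hrange hw hgw hwz, W.posSemidef] with
      t h1 h2 h3 h4 h5 h6 h7
    have e1 : W.innerAt t (f t) (h t) = star (f t) ⬝ᵥ (W.toFun t *ᵥ h t) := by
      rw [Weight.innerAt, star_mulVec, h7.isHermitian.eq, dotProduct_mulVec]
    have e2 : star (v t) ⬝ᵥ (X *ᵥ w t) = star (v t) ⬝ᵥ g t := by
      rw [← h4, mulVec_mulVec, hXJ]
      conv_rhs => rw [← h5, star_mulVec, hTH, ← dotProduct_mulVec]
    have e3 : star (u t) ⬝ᵥ (X *ᵥ z t) = -(star (f t) ⬝ᵥ z t) := by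
      rw [← h3, star_mulVec, ← dotProduct_mulVec, mulVec_mulVec, hJX, neg_mulVec, h6,
        dotProduct_neg]
    have e4 : star (f t) ⬝ᵥ ((H t)ᴴ *ᵥ g t) = star (H t *ᵥ f t) ⬝ᵥ g t := by
      rw [star_mulVec, dotProduct_mulVec]
    rw [e1, Weight.innerAt, h1, h2, hZ]
    simp only [e2, e3, star_add, add_dotProduct, dotProduct_add, e4]
    ring
  have hint : Integrable Z (volume.restrict I) :=
    ((k.integrable_innerAt g).sub (f.integrable_innerAt h)).congr hpt
  have hZ0 : ∀ᵐ t ∂volume.restrict I, t ∉ Icc a b → Z t = 0 := by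
    filter_upwards [hmem, huv] with t h1 h2 h3
    have h4 : t ∈ interior I \ K := ⟨h1, fun h => h3 (Ioo_subset_Icc_self (hKab h))⟩
    rw [hZ]
    simp [hu0 t h4, h2.eq_zero_of_eqOn_isOpen hUo h4 hu0]
  rw [← sub_eq_zero, Weight.L2.inner_def, Weight.L2.inner_def,
    ← integral_sub (k.integrable_innerAt g) (f.integrable_innerAt h), integral_congr_ae hpt]
  rw [setIntegral_eq_of_ae_eq_zero hI habI' hZ0,
    integral_deriv_star_dotProduct X hab (fun i => hu i a b hab habI')
    (fun i => hw i a b hab habI') (ae_restrict_of_ae_restrict_of_subset habI' huv)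
    (ae_restrict_of_ae_restrict_of_subset habI' hwz) (hint.mono_measure
      (Measure.restrict_mono habI' le_rfl)), hua, hub]
  simp

end EasyInclusion

/-! ### Elements of the adjoint relation on compact intervals -/

section AdjointRelation

open Set

variable {n : ℕ} {I : Set ℝ} {W : Weight n I}

namespace Weight.L2

theorem coeFn_sub (f g : W.L2) : ⇑(f - g) =ᵐ[volume.restrict I] fun t => f t - g t :=
  AEEqFun.coeFn_sub f.1 g.1

theorem coeFn_sum {ι : Type*} (s : Finset ι) (f : ι → W.L2) :
    ⇑(∑ i ∈ s, f i) =ᵐ[volume.restrict I] fun t => ∑ i ∈ s, f i t := by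
  classical
  induction s using Finset.induction_on with
  | empty => simpa using coeFn_zero (W := W)
  | insert i s hi ih =>
    simp only [Finset.sum_insert hi]
    filter_upwards [coeFn_add (f i) (∑ j ∈ s, f j), ih] with t h1 h2
    rw [h1, h2]

theorem exists_eq_indicator (f : W.L2) {s : Set ℝ} (hs : MeasurableSet s) :
    ∃ f' : W.L2, ∀ᵐ t ∂volume.restrict I, f' t = s.indicator f t := by
  have hm : AEStronglyMeasurable (s.indicator f) (volume.restrict I) :=
    f.aestronglyMeasurable.indicator hs
  have hae := AEEqFun.coeFn_mk _ hm
  refine ⟨⟨AEEqFun.mk _ hm, ((f.integrable_innerAt f).indicator hs).congr ?_⟩, hae⟩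
  filter_upwards [hae] with t ht
  rw [ht]
  by_cases h : t ∈ s <;> simp [h, Weight.innerAt]

theorem inner_eq_setIntegral (hI : I.OrdConnected) {a b : ℝ} (hab : Icc a b ⊆ I) (f g : W.L2)
    (h : ∀ᵐ t ∂volume.restrict I, t ∉ Icc a b → f t = 0 ∨ g t = 0) :
    inner ℂ f g = ∫ t in Icc a b, W.innerAt t (f t) (g t) := by
  rw [inner_def]
  refine setIntegral_eq_of_ae_eq_zero hI hab ?_
  filter_upwards [h] with t h1 h2
  rcases h1 h2 with h3 | h3 <;> simp [Weight.innerAt, h3]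

end Weight.L2

namespace Reduction

variable {J : Matrix (Fin n) (Fin n) ℂ} {H : ℝ → Matrix (Fin n) (Fin n) ℂ} {n₁ n₂ : ℕ}
  (ρ : Reduction W J H n₁ n₂)

theorem eq_zero_of_coordinates :
    ∀ᵐ t ∂volume.restrict I, ∀ f : Fin n → ℂ, ρ.P *ᵥ f = 0 → ρ.C t *ᵥ f = 0 → f = 0 := by
  filter_upwards [ρ.E_P] with t h f h1 h2
  rw [← one_mulVec f, ← h, add_mulVec, ← mulVec_mulVec, ← mulVec_mulVec, h1, h2]
  simp

/-- The right-hand side `S z + F ζ` of the reduced differential equation, for `k ∈ L²(I; W)`. -/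
noncomputable def source (k : W.L2) (t : ℝ) : Fin n₁ → ℂ :=
  ρ.S t *ᵥ (ρ.P *ᵥ k t) + ρ.F t *ᵥ (ρ.C t *ᵥ k t)

theorem memLp_C_Icc {a b : ℝ} (hab : Icc a b ⊆ I) (f : W.L2) :
    MemLp (fun t => ρ.C t *ᵥ f t) 2 (volume.restrict (Icc a b)) :=
  (ρ.memLp_C f).mono_measure (Measure.restrict_mono hab le_rfl)

theorem integrableOn_source {a b : ℝ} (hab : Icc a b ⊆ I) (k : W.L2) :
    IntegrableOn (ρ.source k) (Icc a b) :=
  (ρ.integrableOn_S hab k).add (memLp_one_iff_integrable.mp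
    (memLp_mulVec (p := 2) (q := 2) (ρ.F_loc.memLp hab) (ρ.memLp_C_Icc hab k)))

theorem integrableOn_A {a b : ℝ} (hab : Icc a b ⊆ I) (i j : Fin n₁) :
    IntegrableOn (fun t => ρ.A t i j) (Icc a b) :=
  memLp_one_iff_integrable.mp (ρ.A_loc.memLp hab i j)

/-- A solution of the reduced differential equation on `[a, b]` with vanishing boundary values
gives an element of the graph of the minimal operator. -/
theorem exists_mem_graph_minOp (hI : I.OrdConnected) {a b : ℝ} (habI : Icc a b ⊆ interior I)
    {e : W.L2} (he : ∀ᵐ t ∂volume.restrict I, t ∉ Icc a b → e t = 0) {y r : ℝ → Fin n₁ → ℂ}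
    (hy : SolvesOn ρ.J₁ ρ.A (ρ.source e) a b y r) (hr : ∀ t ∉ Icc a b, r t = 0)
    (ha : y a = 0) (hb : y b = 0) :
    ∃ f : W.L2, (f, e) ∈ (minOp W J H).graph ∧ ∀ᵐ t ∂volume.restrict I,
      ρ.P *ᵥ f t = (Icc a b).indicator y t ∧
      ρ.C t *ᵥ f t =
        (Icc a b).indicator (fun t => ρ.M t *ᵥ (ρ.C t *ᵥ e t) + ρ.G t *ᵥ y t) t := by
  have habI' : Icc a b ⊆ I := habI.trans interior_subset
  have hθ : MemLp (fun t => ρ.M t *ᵥ (ρ.C t *ᵥ e t) + ρ.G t *ᵥ y t) 2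
      (volume.restrict (Icc a b)) :=
    (memLp_mulVec (p := ⊤) (q := 2) (ρ.M_loc.memLp habI') (ρ.memLp_C_Icc habI' e)).add
      (memLp_mulVec (p := 2) (q := ⊤) (ρ.G_loc.memLp habI') (hy.continuous.memLp_top_Icc a b))
  obtain ⟨f, hf⟩ := ρ.exists_of_coordinates habI' hy.continuous hθ
  -- the solution is supported in `[a, b]` since its derivative is and its boundary values vanish
  have hy0 : ∀ t ∉ Icc a b, y t = 0 := by
    intro t ht
    rcases lt_or_ge t a with h | h
    · rw [hy.eq_add_integral a t, ha, zero_add]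
      refine intervalIntegral.integral_zero_ae ?_
      -- only the endpoint `a` of `(t, a]` belongs to `[a, b]`
      filter_upwards [measure_eq_zero_iff_ae_notMem.mp (measure_singleton (μ := volume) a)]
        with s hsa hs
      rw [uIoc_of_ge h.le] at hs
      exact hr s fun h2 => hsa (le_antisymm hs.2 h2.1)
    · have h' : b < t := not_le.mp fun h2 => ht ⟨h, h2⟩
      rw [hy.eq_add_integral b t, hb, zero_add]
      refine intervalIntegral.integral_zero_ae (Filter.Eventually.of_forall fun s hs => hr s ?_)
      rw [uIoc_of_le h'.le] at hs
      exact fun h2 => absurd h2.2 (not_le.mpr hs.1)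
  refine ⟨f, (mem_graph_minOp_iff hI).mpr ⟨⟨fun t => (ρ.Pᴴ * ρ.J₁) *ᵥ y t,
    fun t => (ρ.Pᴴ * ρ.J₁) *ᵥ r t, fun i c d _ _ =>
      AbsolutelyContinuousOnInterval.mulVec_const _ (hy.absolutelyContinuous c d) i,
    ?_, ?_, ?_⟩, ?_⟩, hf⟩
  · filter_upwards [hf] with t h1
    conv_lhs => rw [ρ.J_eq, ← mulVec_mulVec, h1.1]
    by_cases ht : t ∈ Icc a b
    · rw [indicator_of_mem ht]
    · rw [indicator_of_notMem ht, hy0 t ht]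
  · filter_upwards [ae_restrict_of_ae hy.hasDerivAt] with t ht using ht.mulVec_const _
  · filter_upwards [hf, he, ρ.equation_iff, W.det_ne_zero] with t h1 h2 h3 h4
    have h5 : ρ.Pᴴ *ᵥ (ρ.J₁ *ᵥ r t) + H t *ᵥ f t = W.toFun t *ᵥ e t := by
      rw [h3, h1.1, h1.2]
      by_cases ht : t ∈ Icc a b
      · rw [indicator_of_mem ht, indicator_of_mem ht]
        exact ⟨hy.equation t ht, rfl⟩
      · rw [indicator_of_notMem ht, indicator_of_notMem ht, h2 ht, hr t ht]
        simp
    rw [← mulVec_mulVec, h5, mulVec_mulVec, nonsing_inv_mul _ h4.isUnit, one_mulVec]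
  · refine ⟨Icc a b, isCompact_Icc, habI, ?_⟩
    filter_upwards [hf] with t h1 ht
    conv_lhs => rw [ρ.J_eq, ← mulVec_mulVec, h1.1, indicator_of_notMem ht, mulVec_zero]

/-- An element `(g, h)` of the adjoint relation of the minimal operator satisfies the reduced
adjoint system on every `[a, b]` inside the interior: given a particular solution `w₀` and a
fundamental system `φ`, the difference of `g` and a suitable solution `w₀ + ∑ cᵢ φᵢ`, cut off
outside `[a, b]`, is orthogonal to all solutions of the homogeneous system; it is therefore
in the range of the minimal operator, and as such orthogonal to itself. -/
theorem exists_eq_solution_of_mem_adjoint (hI : I.OrdConnected) {a b : ℝ} (hab : a ≤ b)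
    (habI : Icc a b ⊆ interior I) {g h : W.L2} (hgh : (g, h) ∈ (minOp W J H).graph.adjoint)
    {w₀ s₀ : ℝ → Fin n₁ → ℂ}
    (hw₀ : SolvesOn ρ.J₁ (fun t => (ρ.A t)ᴴ) (ρ.adjoint.source h) a b w₀ s₀)
    {φ s : Fin n₁ → ℝ → Fin n₁ → ℂ}
    (hφ : ∀ i, SolvesOn ρ.J₁ (fun t => (ρ.A t)ᴴ) (fun _ => 0) a b (φ i) (s i))
    (hdet : IsUnit (Matrix.of fun j i => φ i b j).det) :
    ∃ c : Fin n₁ → ℂ, ∀ᵐ t ∂volume.restrict (Icc a b),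
      ρ.P *ᵥ g t = w₀ t + ∑ i, c i • φ i t ∧
      ρ.C t *ᵥ g t = (ρ.M t)ᴴ *ᵥ (ρ.C t *ᵥ h t) +
        (ρ.F t)ᴴ *ᵥ (w₀ t + ∑ i, c i • φ i t) := by
  have habI' : Icc a b ⊆ I := habI.trans interior_subset
  have hF : ∀ {y : ℝ → Fin n₁ → ℂ}, Continuous y →
      MemLp (fun t => (ρ.F t)ᴴ *ᵥ y t) 2 (volume.restrict (Icc a b)) := fun hy =>
    memLp_mulVec (p := 2) (q := ⊤) (ρ.F_loc.conjTranspose.memLp habI') (hy.memLp_top_Icc a b)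
  have hM : MemLp (fun t => (ρ.M t)ᴴ *ᵥ (ρ.C t *ᵥ h t)) 2 (volume.restrict (Icc a b)) :=
    memLp_mulVec (p := ⊤) (q := 2) (ρ.M_loc.conjTranspose.memLp habI') (ρ.memLp_C_Icc habI' h)
  -- `g₁` is `g` cut off to `[a, b]`; `m` and `κ i` are the elements of `L²(I; W)` given there by
  -- the particular solution and by the fundamental system
  obtain ⟨g₁, hg₁⟩ := g.exists_eq_indicator (measurableSet_Icc (a := a) (b := b))
  obtain ⟨m, hm⟩ := ρ.exists_of_coordinates habI' hw₀.continuous (hM.add (hF hw₀.continuous))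
  choose κ hκ using fun i => ρ.exists_of_coordinates habI' (hφ i).continuous
    (hF (hφ i).continuous)
  have : FiniteDimensional ℂ (Submodule.span ℂ (range κ)) :=
    FiniteDimensional.span_of_finite ℂ (finite_range κ)
  obtain ⟨u, hu, e, he, hue⟩ := (Submodule.span ℂ (range κ)).exists_add_mem_mem_orthogonal (g₁ - m)
  obtain ⟨c, hc⟩ := (Submodule.mem_span_range_iff_exists_fun ℂ).mp hu
  have hw := hw₀.add (SolvesOn.sum Finset.univ fun i => (hφ i).const_smul (c i))
  simp only [add_zero] at hw
  set w : ℝ → Fin n₁ → ℂ := fun t => w₀ t + ∑ i, c i • φ i t with hw_def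
  refine ⟨c, ?_⟩
  -- coordinates of `e`
  have hecoord : ∀ᵐ t ∂volume.restrict I,
      ρ.P *ᵥ e t = (Icc a b).indicator (fun t => ρ.P *ᵥ g t - w t) t ∧
      ρ.C t *ᵥ e t = (Icc a b).indicator (fun t => ρ.C t *ᵥ g t -
        ((ρ.M t)ᴴ *ᵥ (ρ.C t *ᵥ h t) + (ρ.F t)ᴴ *ᵥ w t)) t := by
    have h1 : e = (g₁ - m) - ∑ i, c i • κ i := by
      rw [hue, hc]
      abel
    have h2 : ∀ᵐ t ∂volume.restrict I, ∀ i, (c i • κ i) t = c i • κ i t :=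
      ae_all_iff.mpr fun i => Weight.L2.coeFn_smul (c i) (κ i)
    have h3 : ∀ᵐ t ∂volume.restrict I, ∀ i, ρ.P *ᵥ κ i t = (Icc a b).indicator (φ i) t ∧
      ρ.C t *ᵥ κ i t = (Icc a b).indicator (fun t => (ρ.F t)ᴴ *ᵥ φ i t) t :=
      ae_all_iff.mpr hκ
    rw [h1]
    filter_upwards [Weight.L2.coeFn_sub (g₁ - m) (∑ i, c i • κ i), Weight.L2.coeFn_sub g₁ m,
      Weight.L2.coeFn_sum Finset.univ fun i => c i • κ i, h2, h3, hg₁, hm] with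
      t k1 k2 k3 k4 k5 k6 k7
    rw [k1, k2, k3, k6]
    simp only [k4, mulVec_sub, mulVec_sum, mulVec_smul, fun i => (k5 i).1, fun i => (k5 i).2,
      k7.1, k7.2]
    by_cases ht : t ∈ Icc a b
    · simp only [indicator_of_mem ht, hw_def, mulVec_add, mulVec_sum, mulVec_smul, Pi.add_apply]
      exact ⟨by abel, by abel⟩
    · simp only [indicator_of_notMem ht]
      simp
  have he0 : ∀ᵐ t ∂volume.restrict I, t ∉ Icc a b → e t = 0 := by
    filter_upwards [hecoord, ρ.eq_zero_of_coordinates] with t h1 h2 h3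
    rw [indicator_of_notMem h3, indicator_of_notMem h3] at h1
    exact h2 _ h1.1 h1.2
  obtain ⟨y, r, hy, hya, hr⟩ := SolvesOn.exists_solution ρ.isUnit_J₁ (ρ.integrableOn_A habI')
    (ρ.integrableOn_source habI' e) (a := a) (b := b) 0
  -- `y` vanishes at `b` because `e` is orthogonal to the fundamental system
  have hyb : y b = 0 := by
    have h1 : ∀ i, star (y b) ⬝ᵥ (ρ.J₁ *ᵥ φ i b) = 0 := fun i => by
      have h2 := SolvesOn.integral_lagrange ρ.J₁_skew hab hy (hφ i)
      rw [hya] at h2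
      simp only [star_zero, zero_dotProduct, sub_zero, dotProduct_zero, zero_sub] at h2
      rw [← h2, integral_neg, neg_eq_zero]
      have h3 : inner ℂ e (κ i) = 0 := by
        refine inner_eq_zero_symm.mp (he (κ i) (Submodule.subset_span (mem_range_self i)))
      rw [Weight.L2.inner_eq_setIntegral hI habI' e (κ i) (by
        filter_upwards [he0] with t ht h using Or.inl (ht h))] at h3
      rw [← h3]
      refine integral_congr_ae ?_
      filter_upwards [ae_restrict_of_ae_restrict_of_subset habI' (hκ i),
        ae_restrict_of_ae_restrict_of_subset habI' ρ.innerAt_eq,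
        ae_restrict_mem measurableSet_Icc] with t k1 k2 k3
      rw [k2, k1.1, k1.2, indicator_of_mem k3, indicator_of_mem k3, source, star_add,
        add_dotProduct, star_mulVec (ρ.F t), ← dotProduct_mulVec]
    have h2 : (star (y b) ᵥ* ρ.J₁) ᵥ* (Matrix.of fun j i => φ i b j) = 0 := by
      funext i
      rw [Pi.zero_apply, ← h1 i, dotProduct_mulVec]
      rfl
    have h3 : star (y b) ᵥ* ρ.J₁ = 0 := by
      have h4 := congrArg (fun x => x ᵥ* (Matrix.of fun j i => φ i b j)⁻¹) h2
      simp only [zero_vecMul] at h4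
      rwa [vecMul_vecMul, mul_nonsing_inv _ hdet, vecMul_one] at h4
    have h5 := congrArg (fun x => x ᵥ* ρ.J₁⁻¹) h3
    simpa [vecMul_vecMul, mul_nonsing_inv _ ρ.isUnit_J₁] using h5
  -- test the adjoint relation against the element `f` of the minimal domain with image `e`
  obtain ⟨f, hfe, hf⟩ := ρ.exists_mem_graph_minOp hI habI he0 hy hr hya hyb
  have hadj : inner ℂ e g - inner ℂ f h = 0 :=
    (Submodule.mem_adjoint_iff _ _).mp hgh f e hfe
  have hf0 : ∀ᵐ t ∂volume.restrict I, t ∉ Icc a b → f t = 0 := by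
    filter_upwards [hf, ρ.eq_zero_of_coordinates] with t h1 h2 h3
    rw [indicator_of_notMem h3, indicator_of_notMem h3] at h1
    exact h2 _ h1.1 h1.2
  -- by Lagrange's identity, `⟨e, e⟩` differs from `⟨e, g⟩ - ⟨f, h⟩` by boundary terms, which vanish
  have hee : inner ℂ e e = 0 := by
    have h1 := SolvesOn.integral_lagrange ρ.J₁_skew hab hy hw
    rw [hya, hyb] at h1
    simp only [star_zero, zero_dotProduct, sub_zero] at h1
    have hsub : ∀ k₁ k₂ : W.L2, IntegrableOn (fun t => W.innerAt t (k₁ t) (k₂ t)) (Icc a b) :=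
      fun k₁ k₂ => (k₁.integrable_innerAt k₂).mono_measure (Measure.restrict_mono habI' le_rfl)
    have hsub' : IntegrableOn (fun t => W.innerAt t (e t) (g t) - W.innerAt t (f t) (h t))
        (Icc a b) := (hsub e g).sub (hsub f h)
    have h2 : inner ℂ e e - (inner ℂ e g - inner ℂ f h) = 0 := by
      rw [Weight.L2.inner_eq_setIntegral hI habI' e e (by
          filter_upwards [he0] with t ht h using Or.inl (ht h)),
        Weight.L2.inner_eq_setIntegral hI habI' e g (by
          filter_upwards [he0] with t ht h using Or.inl (ht h)),
        Weight.L2.inner_eq_setIntegral hI habI' f h (by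
          filter_upwards [hf0] with t ht h using Or.inl (ht h)),
        ← integral_sub (hsub e g) (hsub f h), ← integral_sub (hsub e e) hsub',
        ← h1]
      refine integral_congr_ae ?_
      filter_upwards [ae_restrict_of_ae_restrict_of_subset habI' hecoord,
        ae_restrict_of_ae_restrict_of_subset habI' hf,
        ae_restrict_of_ae_restrict_of_subset habI' ρ.innerAt_eq,
        ae_restrict_of_ae_restrict_of_subset habI' ρ.S_posSemidef,
        ae_restrict_mem measurableSet_Icc] with t k1 k2 k3 k4 k5
      rw [indicator_of_mem k5, indicator_of_mem k5] at k1 k2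
      have e1 : ρ.P *ᵥ g t = ρ.P *ᵥ e t + w t := by rw [k1.1]; abel
      have e2 : ρ.C t *ᵥ g t = ρ.C t *ᵥ e t +
          ((ρ.M t)ᴴ *ᵥ (ρ.C t *ᵥ h t) + (ρ.F t)ᴴ *ᵥ w t) := by rw [k1.2]; abel
      have e3 : ∀ x, star (ρ.S t *ᵥ y t) ⬝ᵥ x = star (y t) ⬝ᵥ (ρ.S t *ᵥ x) := fun x => by
        rw [star_mulVec, k4.isHermitian.eq, dotProduct_mulVec]
      have e4 : ∀ {k l : ℕ} (B : Matrix (Fin k) (Fin l) ℂ) (x : Fin l → ℂ) (z : Fin k → ℂ),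
          star (B *ᵥ x) ⬝ᵥ z = star x ⬝ᵥ (Bᴴ *ᵥ z) := fun B x z => by
        rw [star_mulVec, dotProduct_mulVec]
      rw [k3, k3, k3, k2.1, k2.2, e1, e2, source, source]
      change _ = star (y t) ⬝ᵥ (ρ.S t *ᵥ (ρ.P *ᵥ h t) + (ρ.G t)ᴴ *ᵥ (ρ.C t *ᵥ h t)) - _
      simp only [star_add, add_dotProduct, dotProduct_add, e3, e4 (ρ.M t), e4 (ρ.F t),
        e4 (ρ.G t)]
      ring
    rwa [hadj, sub_zero] at h2
  have he_zero : e = 0 := inner_self_eq_zero.mp hee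
  filter_upwards [ae_restrict_of_ae_restrict_of_subset habI' hecoord,
    ae_restrict_of_ae_restrict_of_subset habI' (Weight.L2.coeFn_zero (W := W)),
    ae_restrict_mem measurableSet_Icc] with t k1 k2 k3
  rw [he_zero, k2, mulVec_zero, mulVec_zero, indicator_of_mem k3, indicator_of_mem k3] at k1
  exact ⟨(sub_eq_zero.mp k1.1.symm), (sub_eq_zero.mp k1.2.symm)⟩

end Reduction

end AdjointRelation

/-! ### Gluing, and the adjoint of the minimal operator -/

section Gluing

open Set

variable {n : ℕ} {I : Set ℝ} {W : Weight n I}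

/-- A property that holds almost everywhere on all large compact subintervals of an interval
holds almost everywhere on the interval. -/
theorem ae_restrict_of_forall_Icc (hI : I.OrdConnected) {a₀ b₀ : ℝ} (hab₀ : a₀ ≤ b₀)
    (hI₀ : Icc a₀ b₀ ⊆ I) {p : ℝ → Prop}
    (h : ∀ a b, a ≤ a₀ → b₀ ≤ b → Icc a b ⊆ I → ∀ᵐ t ∂volume.restrict (Icc a b), p t) :
    ∀ᵐ t ∂volume.restrict I, p t := by
  have h1 : volume {t | t ∈ interior I ∧ ¬p t} = 0 := by
    refine measure_null_of_locally_null _ fun x hx => ?_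
    obtain ⟨ε, hε, h2⟩ :=
      Metric.nhds_basis_closedBall.mem_iff.mp (mem_interior_iff_mem_nhds.mp hx.1)
    rw [Real.closedBall_eq_Icc] at h2
    have h3 : Icc (min a₀ (x - ε)) (max b₀ (x + ε)) ⊆ I := by
      refine hI.out ?_ ?_
      · rcases min_choice a₀ (x - ε) with h4 | h4 <;> rw [h4]
        · exact hI₀ (left_mem_Icc.mpr hab₀)
        · exact h2 (left_mem_Icc.mpr (by linarith))
      · rcases max_choice b₀ (x + ε) with h4 | h4 <;> rw [h4]
        · exact hI₀ (right_mem_Icc.mpr hab₀)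
        · exact h2 (right_mem_Icc.mpr (by linarith))
    refine ⟨_, Filter.inter_mem self_mem_nhdsWithin (mem_nhdsWithin_of_mem_nhds
      (Icc_mem_nhds (show min a₀ (x - ε) < x from (min_le_right _ _).trans_lt (by linarith))
        (show x < max b₀ (x + ε) from lt_of_lt_of_le (by linarith) (le_max_right _ _)))), ?_⟩
    have h5 := (ae_restrict_iff' measurableSet_Icc).mp (h _ _ (min_le_left _ _)
      (le_max_left _ _) h3)
    refine measure_mono_null (fun t ht => ?_) (ae_iff.mp h5)
    exact fun h6 => ht.1.2 (h6 ht.2)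
  filter_upwards [ae_mem_interior hI, ae_restrict_of_ae (measure_eq_zero_iff_ae_notMem.mp h1)]
    with t h2 h3
  by_contra h4
  exact h3 ⟨h2, h4⟩

namespace Reduction

variable {J : Matrix (Fin n) (Fin n) ℂ} {H : ℝ → Matrix (Fin n) (Fin n) ℂ} {n₁ n₂ : ℕ}
  (ρ : Reduction W J H n₁ n₂)

/-- An element of the adjoint relation of the minimal operator satisfies the reduced adjoint
system on every compact subinterval of `I`, up to the endpoints of `I`: a particular solution and a
fundamental system on `[a, b]` represent it on all smaller intervals with the same constants. -/
theorem exists_solution_of_mem_adjoint (hI : I.OrdConnected) {a b : ℝ} (hab : a < b)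
    (habI : Icc a b ⊆ I) {g h : W.L2} (hgh : (g, h) ∈ (minOp W J H).graph.adjoint) :
    ∃ w s, SolvesOn ρ.J₁ (fun t => (ρ.A t)ᴴ) (ρ.adjoint.source h) a b w s ∧
      ∀ᵐ t ∂volume.restrict (Icc a b), ρ.P *ᵥ g t = w t ∧
        ρ.C t *ᵥ g t = (ρ.M t)ᴴ *ᵥ (ρ.C t *ᵥ h t) + (ρ.F t)ᴴ *ᵥ w t := by
  obtain ⟨w₀, s₀, hw₀, -, -⟩ := SolvesOn.exists_solution (a := a) (b := b) ρ.isUnit_J₁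
    (ρ.adjoint.integrableOn_A habI) (ρ.adjoint.integrableOn_source habI h) 0
  obtain ⟨φ, s, hφ, hdet⟩ := SolvesOn.exists_fundamental_system ρ.isUnit_J₁ ρ.J₁_skew
    (ρ.integrableOn_A habI)
  have hint : Ioo a b ⊆ interior I :=
    interior_maximal (Ioo_subset_Icc_self.trans habI) isOpen_Ioo
  have hloc : ∀ a' b', a' ≤ b' → Icc a' b' ⊆ Ioo a b → ∃ c : Fin n₁ → ℂ,
      ∀ᵐ t ∂volume.restrict (Icc a' b'), ρ.P *ᵥ g t = w₀ t + ∑ i, c i • φ i t ∧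
        ρ.C t *ᵥ g t = (ρ.M t)ᴴ *ᵥ (ρ.C t *ᵥ h t) +
          (ρ.F t)ᴴ *ᵥ (w₀ t + ∑ i, c i • φ i t) := fun a' b' h1 h2 => by
    have h3 := h2.trans Ioo_subset_Icc_self
    exact ρ.exists_eq_solution_of_mem_adjoint hI h1 (h2.trans hint) hgh (hw₀.mono h3)
      (fun i => (hφ i).mono h3) (hdet b' (h3 (right_mem_Icc.mpr h1)))
  obtain ⟨a₀, ha₀, ha₀'⟩ := exists_between hab
  obtain ⟨b₀, hb₀, hb₀'⟩ := exists_between ha₀'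
  have hI₀ : Icc a₀ b₀ ⊆ Ioo a b := Icc_subset_Ioo ha₀ hb₀'
  obtain ⟨c, hc⟩ := hloc a₀ b₀ hb₀.le hI₀
  have hw := SolvesOn.add (A := fun t => (ρ.A t)ᴴ) hw₀ (SolvesOn.sum Finset.univ fun i =>
    (hφ i).const_smul (c i))
  simp only [add_zero] at hw
  refine ⟨_, _, hw, ?_⟩
  rw [← restrict_Ioo_eq_restrict_Icc]
  refine ae_restrict_of_forall_Icc ordConnected_Ioo hb₀.le hI₀ fun a' b' ha' hb' hI' => ?_
  obtain ⟨c', hc'⟩ := hloc a' b' (ha'.trans (hb₀.le.trans hb')) hI'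
  have hsub : Icc a₀ b₀ ⊆ Icc a' b' := Icc_subset_Icc ha' hb'
  -- both representations agree at a point of `[a₀, b₀]`, where the fundamental system is invertible
  have hcc : c' = c := by
    have h1 : ∀ᵐ t ∂volume.restrict (Icc a₀ b₀), t ∈ Icc a₀ b₀ ∧
        ∑ i, c' i • φ i t = ∑ i, c i • φ i t := by
      filter_upwards [hc, ae_restrict_of_ae_restrict_of_subset hsub hc',
        ae_restrict_mem measurableSet_Icc] with t k1 k2 k3
      exact ⟨k3, add_left_cancel (k2.1.symm.trans k1.1)⟩
    have : (ae (volume.restrict (Icc a₀ b₀))).NeBot := by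
      rw [ae_neBot, Ne, Measure.restrict_eq_zero, Real.volume_Icc, ENNReal.ofReal_eq_zero]
      linarith
    obtain ⟨t, ht, h2⟩ := h1.exists
    have h3 : ∀ d : Fin n₁ → ℂ, ∑ i, d i • φ i t = (Matrix.of fun j i => φ i t j) *ᵥ d :=
      fun d => by
        ext j
        simp [mulVec, dotProduct, mul_comm]
    rw [h3, h3] at h2
    exact mulVec_injective_of_isUnit ((isUnit_iff_isUnit_det _).mpr
      (hdet t (Ioo_subset_Icc_self (hI₀ ht)))) h2
  rwa [hcc] at hc'

/-- The adjoint relation of the minimal operator for `H` is contained in the graph of the maximal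
operator for `H^*`. The solutions on compact subintervals are restrictions of the primitive of
`J₁⁻¹ (S P h + Gᴴ C h - Aᴴ P g)`. -/
theorem isDAImage_of_mem_adjoint (ρ : Reduction W J H n₁ n₂) (hI : I.OrdConnected)
    (hI_int : (interior I).Nonempty) {g h : W.L2} (hgh : (g, h) ∈ (minOp W J H).graph.adjoint) :
    IsDAImage I J (fun t => (H t)ᴴ) W.toFun g h := by
  obtain ⟨c₀, hc₀⟩ := hI_int
  obtain ⟨ε, hε, hI₀⟩ :=
    Metric.nhds_basis_closedBall.mem_iff.mp (mem_interior_iff_mem_nhds.mp hc₀)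
  rw [Real.closedBall_eq_Icc] at hI₀
  set a₀ := c₀ - ε with ha₀
  set b₀ := c₀ + ε with hb₀
  have hab₀ : a₀ < b₀ := by linarith
  obtain ⟨w₀, s₀, hw₀, hgw₀⟩ := ρ.exists_solution_of_mem_adjoint hI hab₀ hI₀ hgh
  set r : ℝ → Fin n₁ → ℂ := fun t =>
    ρ.J₁⁻¹ *ᵥ (ρ.adjoint.source h t - (ρ.A t)ᴴ *ᵥ (ρ.P *ᵥ g t)) with hr
  set w : ℝ → Fin n₁ → ℂ := fun t => w₀ c₀ + ∫ x in c₀..t, r x with hw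
  have hkey : ∀ a b, a ≤ a₀ → b₀ ≤ b → Icc a b ⊆ I → IntervalIntegrable r volume a b ∧
      ∀ᵐ t ∂volume.restrict (Icc a b), ρ.P *ᵥ g t = w t ∧
        ρ.C t *ᵥ g t = (ρ.M t)ᴴ *ᵥ (ρ.C t *ᵥ h t) + (ρ.F t)ᴴ *ᵥ w t := by
    intro a b ha hb habI
    have hab : a < b := by linarith
    obtain ⟨w', s', hw', hgw'⟩ := ρ.exists_solution_of_mem_adjoint hI hab habI hgh
    have hrs : ∀ᵐ t ∂volume.restrict (Icc a b), s' t = r t := by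
      filter_upwards [hgw', ae_restrict_mem measurableSet_Icc] with t h1 h2
      rw [hr]
      simp only
      rw [← hw'.equation t h2, h1.1, add_sub_cancel_right, mulVec_mulVec,
        nonsing_inv_mul _ ρ.isUnit_J₁, one_mulVec]
    have hri : IntervalIntegrable r volume a b :=
      (intervalIntegrable_iff_integrableOn_Icc_of_le hab.le).mpr
        (hw'.integrable.integrableOn.congr hrs)
    -- continuous functions equal almost everywhere near `c₀` are equal at `c₀`
    have hc : w' c₀ = w₀ c₀ := by
      have h1 : w' =ᵐ[volume.restrict (Ioo a₀ b₀)] w₀ := by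
        filter_upwards [ae_restrict_of_ae_restrict_of_subset Ioo_subset_Icc_self hgw₀,
          ae_restrict_of_ae_restrict_of_subset
            (Ioo_subset_Icc_self.trans (Icc_subset_Icc ha hb)) hgw'] with t h1 h2
        rw [← h1.1, h2.1]
      exact Measure.eqOn_open_of_ae_eq h1 isOpen_Ioo hw'.continuous.continuousOn
        hw₀.continuous.continuousOn ⟨by linarith, by linarith⟩
    have hww : ∀ t ∈ Icc a b, w' t = w t := by
      intro t ht
      rw [hw'.eq_add_integral c₀ t, hc, hw]
      simp only
      congr 1
      refine intervalIntegral.integral_congr_ae ?_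
      filter_upwards [(ae_restrict_iff' measurableSet_Icc).mp hrs] with x h1 h2
      have h3 : uIcc c₀ t ⊆ Icc a b :=
        ordConnected_Icc.uIcc_subset ⟨by linarith, by linarith⟩ ht
      exact h1 (h3 (uIoc_subset_uIcc h2))
    refine ⟨hri, ?_⟩
    filter_upwards [hgw', ae_restrict_mem measurableSet_Icc] with t h1 h2
    rw [← hww t h2]
    exact h1
  have hJr : ∀ t, ρ.J₁ *ᵥ r t = ρ.adjoint.source h t - (ρ.A t)ᴴ *ᵥ (ρ.P *ᵥ g t) := fun t => by
    rw [hr]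
    simp only
    rw [mulVec_mulVec, mul_nonsing_inv _ ρ.isUnit_J₁, one_mulVec]
  have hgw : ∀ᵐ t ∂volume.restrict I, ρ.P *ᵥ g t = w t ∧
      ρ.C t *ᵥ g t = (ρ.M t)ᴴ *ᵥ (ρ.C t *ᵥ h t) + (ρ.F t)ᴴ *ᵥ w t :=
    ae_restrict_of_forall_Icc hI hab₀.le hI₀ fun a b ha hb habI => (hkey a b ha hb habI).2
  have hwr : ∀ᵐ t ∂volume.restrict I, HasDerivAt w (r t) t := by
    refine ae_restrict_of_forall_Icc hI hab₀.le hI₀ fun a b ha hb habI => ?_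
    have hab : a ≤ b := by linarith
    filter_upwards [ae_restrict_of_ae (hkey a b ha hb habI).1.ae_hasDerivAt_integral,
      ae_restrict_mem measurableSet_Icc] with t h1 h2
    rw [uIcc_of_le hab] at h1
    exact (h1 h2 c₀ ⟨by linarith, by linarith⟩).const_add _
  refine ⟨fun t => (ρ.Pᴴ * ρ.J₁) *ᵥ w t, fun t => (ρ.Pᴴ * ρ.J₁) *ᵥ r t,
    fun i c d hcd hI' => AbsolutelyContinuousOnInterval.mulVec_const _ (fun j => ?_) i, ?_, ?_, ?_⟩
  · have hsub : Icc (min c a₀) (max d b₀) ⊆ I := by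
      refine hI.out ?_ ?_
      · rcases min_choice c a₀ with h4 | h4 <;> rw [h4]
        · exact hI' (left_mem_Icc.mpr hcd)
        · exact hI₀ (left_mem_Icc.mpr hab₀.le)
      · rcases max_choice d b₀ with h4 | h4 <;> rw [h4]
        · exact hI' (right_mem_Icc.mpr hcd)
        · exact hI₀ (right_mem_Icc.mpr hab₀.le)
    have h1 := (hkey _ _ (min_le_right c a₀) (le_max_right d b₀) hsub).1
    have h2 : min c a₀ ≤ max d b₀ := (min_le_left _ _).trans (hcd.trans (le_max_left _ _))
    have h3 : AbsolutelyContinuousOnInterval w (min c a₀) (max d b₀) := by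
      refine .of_dist_le 1 (h1.absolutelyContinuousOnInterval_primitive (c := c₀) ?_)
        fun x _ y _ => ?_
      · rw [uIcc_of_le h2]
        exact ⟨(min_le_right _ _).trans (by linarith), le_trans (by linarith) (le_max_right _ _)⟩
      · rw [hw, dist_add_left, one_mul]
    refine (h3.mono ?_).eval j
    rw [uIcc_of_le h2, uIcc_of_le hcd]
    exact Icc_subset_Icc (min_le_left _ _) (le_max_left _ _)
  · filter_upwards [hgw] with t h1
    conv_lhs => rw [ρ.J_eq, ← mulVec_mulVec, h1.1]
  · filter_upwards [hwr] with t h1 using h1.mulVec_const _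
  · filter_upwards [hgw, ρ.adjoint.equation_iff, W.det_ne_zero] with t h1 h2 h3
    have h4 : ρ.Pᴴ *ᵥ (ρ.J₁ *ᵥ r t) + (H t)ᴴ *ᵥ g t = W.toFun t *ᵥ h t := by
      refine (h2 _ _ _).mpr ⟨?_, ?_⟩
      · rw [hJr]
        exact sub_add_cancel _ _
      · change ρ.C t *ᵥ g t = (ρ.M t)ᴴ *ᵥ (ρ.C t *ᵥ h t) + (ρ.F t)ᴴ *ᵥ (ρ.P *ᵥ g t)
        rw [h1.1]
        exact h1.2
    rw [← mulVec_mulVec, h4, mulVec_mulVec, nonsing_inv_mul _ h3.isUnit, one_mulVec]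

/-- The adjoint relation of the minimal operator for `H` is the graph of the maximal operator
for `H^*`. -/
theorem graph_adjoint_minOp (ρ : Reduction W J H n₁ n₂) (hI : I.OrdConnected)
    (hI_int : (interior I).Nonempty) :
    (minOp W J H).graph.adjoint = (maxOp W J fun t => (H t)ᴴ).graph := by
  ext ⟨g, h⟩
  rw [mem_graph_maxOp_iff hI]
  refine ⟨ρ.isDAImage_of_mem_adjoint hI hI_int, fun hgh => ?_⟩
  rw [Submodule.mem_adjoint_iff]
  intro f k hfk
  obtain ⟨h1, h2⟩ := (mem_graph_minOp_iff hI).mp hfk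
  rw [ρ.inner_eq_inner hI hI_int h1 h2 hgh, sub_self]

end Reduction

end Gluing

theorem mainTheorem4 {n : ℕ} {I : Set ℝ} (hI : I.OrdConnected) (hI_int : (interior I).Nonempty)
    (J : Matrix (Fin n) (Fin n) ℂ) (hJ_ne : J ≠ 0) (hJ_skew : Jᴴ = -J)
    (H : ℝ → Matrix (Fin n) (Fin n) ℂ)
    (hH : ∀ i j, AEStronglyMeasurable (fun t => H t i j) (volume.restrict I))
    (W : Weight n I) (hidx : LocalIndexOne I J H W.toFun) :
    (Dense ((minOp W J H).domain : Set W.L2) ∧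
      Dense ((minOp W J fun t => (H t)ᴴ).domain : Set W.L2) ∧
      Dense ((maxOp W J H).domain : Set W.L2) ∧
      Dense ((maxOp W J fun t => (H t)ᴴ).domain : Set W.L2)) ∧
    ((maxOp W J fun t => (H t)ᴴ).IsClosed ∧
      (minOp W J H).IsClosable ∧
      (minOp W J H).closure = (minOp W J H).adjoint.adjoint ∧
      (minOp W J H).adjoint = (maxOp W J fun t => (H t)ᴴ) ∧
      (minOp W J H).closure.adjoint = (maxOp W J fun t => (H t)ᴴ) ∧
      (maxOp W J fun t => (H t)ᴴ).closure = (maxOp W J fun t => (H t)ᴴ) ∧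
      (maxOp W J fun t => (H t)ᴴ).adjoint.adjoint = (maxOp W J fun t => (H t)ᴴ) ∧
      (maxOp W J fun t => (H t)ᴴ).adjoint = (minOp W J H).closure) ∧
    ((maxOp W J H).IsClosed ∧
      (minOp W J fun t => (H t)ᴴ).IsClosable ∧
      (minOp W J fun t => (H t)ᴴ).closure = (minOp W J fun t => (H t)ᴴ).adjoint.adjoint ∧
      (minOp W J fun t => (H t)ᴴ).adjoint = maxOp W J H ∧
      (minOp W J fun t => (H t)ᴴ).closure.adjoint = maxOp W J H ∧
      (maxOp W J H).closure = maxOp W J H ∧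
      (maxOp W J H).adjoint.adjoint = maxOp W J H ∧
      (maxOp W J H).adjoint = (minOp W J fun t => (H t)ᴴ).closure) := by
  obtain ⟨n₁, n₂, ⟨ρ⟩⟩ := exists_reduction hJ_skew hidx
  have h1 := ρ.graph_adjoint_minOp hI hI_int
  have h2 := ρ.adjoint.graph_adjoint_minOp hI hI_int
  simp only [conjTranspose_conjTranspose] at h2
  -- the domains of the minimal operators are dense, and those of the maximal ones are larger
  have d1 := LinearPMap.dense_domain_of_graph_adjoint h1
  have d2 := LinearPMap.dense_domain_of_graph_adjoint h2
  have d3 : Dense ((maxOp W J H).domain : Set W.L2) :=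
    d1.mono (LinearPMap.domRestrict_le (f := maxOp W J H)).1
  have d4 : Dense ((maxOp W J fun t => (H t)ᴴ).domain : Set W.L2) :=
    d2.mono (LinearPMap.domRestrict_le (f := maxOp W J fun t => (H t)ᴴ)).1
  exact ⟨⟨d1, d2, d3, d4⟩, LinearPMap.adjoint_pair h1 d4, LinearPMap.adjoint_pair h2 d3⟩
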